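/- Let $K$ be an imaginary quadratic number field with ring of integers $\mathcal{O}$, embedded in $\mathbb{C}$, and let $\Gamma'$ be a torsion-free subgroup of the Bianchi group $PSL_2(\mathcal{O})\subset PSL_2(\mathbb{C})$ such that the hyperbolic 3-manifold $M'=\mathbb{H}^3/\Gamma'$ has finite volume. For an ideal $I$ of $\mathcal{O}$ let $\Gamma'_0(I)$, $\Gamma'_1(I)$, $\Gamma'(I)$ be the subgroups of those elements of $\Gamma'$ that are represented by a matrix in $SL_2(\mathcal{O})$ which is congruent modulo $I$ to, respectively, $\begin{pmatrix} * & * \\ 0 & * \end{pmatrix}$, $\pm\begin{pmatrix} 1 & * \\ 0 & 1 \end{pmatrix}$, $\pm\begin{pmatrix} 1 & 0 \\ 0 & 1 \end{pmatrix}$, and let $M'_0(I)$, $M'_1(I)$, $M'(I)$ be the quotients of $\mathbb{H}^3$ by these subgroups, which are finite covers of $M'$. An embedded ball in such a quotient is the image of a hyperbolic ball of positive radius in $\mathbb{H}^3$ on which the projection is injective. Then there is a finite set $S$ of nonzero prime ideals of $\mathcal{O}$, depending only on $\Gamma'$, such that the following statements hold for all square-free ideals $I$ of $\mathcal{O}$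 with no prime factor in $S$. (i) For every $\epsilon>0$ there is $d>0$, depending only on $\epsilon$ and $\Gamma'$, such that if $[\Gamma':\Gamma'_0(I)]>d$, then $M'_0(I)$ contains an embedded ball $B$ with $\mathrm{vol}(B)>\mathrm{vol}(M'_0(I))^{1/2-\epsilon}$. (ii) There are $c>0$ and $d>0$, depending only on $\Gamma'$, such that if $[\Gamma':\Gamma'_1(I)]>d$, then $M'_1(I)$ contains an embedded ball $B$ with $\mathrm{vol}(B)>c\,\mathrm{vol}(M'_1(I))^{1/4}$. (iii) There are $c>0$ and $d>0$, depending only on $\Gamma'$, such that if $[\Gamma':\Gamma'(I)]>d$, then $M'(I)$ contains an embedded ball $B$ with $\mathrm{vol}(B)>c\,\mathrm{vol}(M'(I))^{1/3}$. -/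

import Mathlib

open scoped ENNReal ComplexConjugate MatrixGroups NumberField

noncomputable section

namespace HypThree

/-- Hyperbolic 3-space `ℍ³` in the upper half-space model: the points `z + t j` with `z` complex
and `t > 0`. -/
def H3 : Type := {p : ℂ × ℝ // 0 < p.2}

namespace H3

/-- The complex coordinate of a point of `ℍ³`. -/
def z (p : H3) : ℂ := p.1.1

/-- The height of a point of `ℍ³`. -/
def t (p : H3) : ℝ := p.1.2

theorem t_pos (p : H3) : 0 < p.t := p.2

theorem ext' {p q : H3} (hz : p.z = q.z) (ht : p.t = q.t) : p = q :=
  Subtype.ext (Prod.ext hz ht)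

/-- The hyperbolic distance, `cosh d(p, q) = 1 + (|z - z'|² + (t - t')²) / (2 t t')`. -/
def dist (p q : H3) : ℝ :=
  Real.arcosh (1 + (‖p.z - q.z‖ ^ 2 + (p.t - q.t) ^ 2) / (2 * p.t * q.t))

/-- The open hyperbolic ball of centre `p` and radius `r`. -/
def ball (p : H3) (r : ℝ) : Set H3 := {q | dist p q < r}

instance : MeasureTheory.MeasureSpace H3 where
  toMeasurableSpace := Subtype.instMeasurableSpace
  /- The hyperbolic volume `dx dy dt / t³`. -/
  volume := ((MeasureTheory.volume : MeasureTheory.Measure (ℂ × ℝ)).comap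
    (Subtype.val : {p : ℂ × ℝ // 0 < p.2} → ℂ × ℝ)).withDensity
      (fun p => ENNReal.ofReal (1 / p.1.2 ^ 3))

/-- `|c z + d|² + |c|² t²`, the denominator of the Möbius action. -/
def den (g : SL(2, ℂ)) (p : H3) : ℝ :=
  Complex.normSq (g 1 0 * p.z + g 1 1) + Complex.normSq (g 1 0) * p.t ^ 2

/-- `(a z + b) conj (c z + d) + a conj c t²`, the numerator of the Möbius action. -/
def num (g : SL(2, ℂ)) (p : H3) : ℂ :=
  (g 0 0 * p.z + g 0 1) * conj (g 1 0 * p.z + g 1 1) + g 0 0 * conj (g 1 0) * (p.t : ℂ) ^ 2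

theorem det_eq (g : SL(2, ℂ)) : g 0 0 * g 1 1 - g 0 1 * g 1 0 = 1 := by
  have := g.det_coe
  rwa [Matrix.det_fin_two] at this

theorem den_pos (g : SL(2, ℂ)) (p : H3) : 0 < den g p := by
  have ht := p.t_pos
  have h1 := Complex.normSq_nonneg (g 1 0 * p.z + g 1 1)
  have h2 := Complex.normSq_nonneg (g 1 0)
  by_cases hc : g 1 0 = 0
  · have hd : g 1 1 ≠ 0 := by
      intro hd
      have := det_eq g
      simp [hc, hd] at this
    have : 0 < Complex.normSq (g 1 1) := Complex.normSq_pos.mpr hd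
    simpa [den, hc] using this
  · have : 0 < Complex.normSq (g 1 0) := Complex.normSq_pos.mpr hc
    unfold den
    positivity

theorem den_coe (g : SL(2, ℂ)) (p : H3) :
    (den g p : ℂ) = (g 1 0 * p.z + g 1 1) * conj (g 1 0 * p.z + g 1 1)
      + g 1 0 * conj (g 1 0) * (p.t : ℂ) ^ 2 := by
  rw [Complex.mul_conj, Complex.mul_conj]
  simp [den]

/-- The action of `SL₂(ℂ)` on `ℍ³` by Möbius transformations (Poincaré extension), i.e.
`w ↦ (a w + b) (c w + d)⁻¹` on the quaternions `w = z + t j`. -/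
instance : SMul SL(2, ℂ) H3 where
  smul g p := ⟨(num g p / (den g p : ℂ), p.t / den g p), div_pos p.t_pos (den_pos g p)⟩

theorem smul_z (g : SL(2, ℂ)) (p : H3) : (g • p).z = num g p / (den g p : ℂ) := rfl

theorem smul_t (g : SL(2, ℂ)) (p : H3) : (g • p).t = p.t / den g p := rfl

theorem key_norm (g : SL(2, ℂ)) (p : H3) :
    num g p * conj (num g p) + (p.t : ℂ) ^ 2 = (den g p : ℂ) *
      ((g 0 0 * p.z + g 0 1) * conj (g 0 0 * p.z + g 0 1)
        + g 0 0 * conj (g 0 0) * (p.t : ℂ) ^ 2) := by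
  have h := det_eq g
  have h' : conj (g 0 0) * conj (g 1 1) - conj (g 0 1) * conj (g 1 0) = 1 := by
    simpa using congrArg conj h
  rw [den_coe]
  simp only [num, map_add, map_mul, map_pow, Complex.conj_conj, Complex.conj_ofReal]
  linear_combination (-(p.t : ℂ) ^ 2) * h - ((p.t : ℂ) ^ 2 * (g 0 0 * g 1 1 - g 0 1 * g 1 0)) * h'

theorem den_mul (g h : SL(2, ℂ)) (p : H3) : den (g * h) p = den g (h • p) * den h p := by
  have hD := (den_pos h p).ne'
  have hD' : (den h p : ℂ) ≠ 0 := by exact_mod_cast hD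
  have key := key_norm h p
  apply Complex.ofReal_injective
  rw [Complex.ofReal_mul, den_coe g, den_coe (g * h), smul_z, smul_t]
  simp only [Matrix.SpecialLinearGroup.coe_mul, Matrix.mul_apply, Fin.sum_univ_two]
  push_cast
  simp only [map_add, map_mul, map_div₀, Complex.conj_ofReal]
  field_simp
  have hd := den_coe h p
  have hn : num h p = (h 0 0 * p.z + h 0 1) * conj (h 1 0 * p.z + h 1 1)
    + h 0 0 * conj (h 1 0) * (p.t : ℂ) ^ 2 := rfl
  have hn' : conj (num h p) = conj (h 0 0 * p.z + h 0 1) * (h 1 0 * p.z + h 1 1)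
      + conj (h 0 0) * h 1 0 * (p.t : ℂ) ^ 2 := by
    rw [hn]; simp
  simp only [map_add, map_mul] at hd hn hn' key
  linear_combination (-(g 1 0 * conj (g 1 0))) * key
    - g 1 0 * conj (g 1 1) * (den h p : ℂ) * hn - g 1 1 * conj (g 1 0) * (den h p : ℂ) * hn'
    - g 1 1 * conj (g 1 1) * (den h p : ℂ) * hd

theorem num_mul (g h : SL(2, ℂ)) (p : H3) :
    num (g * h) p = num g (h • p) * (den h p : ℂ) := by
  have hD := (den_pos h p).ne'
  have hD' : (den h p : ℂ) ≠ 0 := by exact_mod_cast hD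
  have key := key_norm h p
  unfold num at *
  rw [smul_z, smul_t]
  simp only [Matrix.SpecialLinearGroup.coe_mul, Matrix.mul_apply, Fin.sum_univ_two]
  push_cast
  simp only [map_add, map_mul, map_div₀, Complex.conj_ofReal]
  field_simp
  have hd := den_coe h p
  have hn : num h p = (h 0 0 * p.z + h 0 1) * conj (h 1 0 * p.z + h 1 1)
    + h 0 0 * conj (h 1 0) * (p.t : ℂ) ^ 2 := rfl
  have hn' : conj (num h p) = conj (h 0 0 * p.z + h 0 1) * (h 1 0 * p.z + h 1 1)
      + conj (h 0 0) * h 1 0 * (p.t : ℂ) ^ 2 := by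
    rw [hn]; simp
  have key := key_norm h p
  simp only [map_add, map_mul] at hd hn hn' key
  linear_combination (-(g 0 0 * conj (g 1 0))) * key
    - g 0 0 * conj (g 1 1) * (den h p : ℂ) * hn - g 0 1 * conj (g 1 0) * (den h p : ℂ) * hn'
    - g 0 1 * conj (g 1 1) * (den h p : ℂ) * hd

instance : MulAction SL(2, ℂ) H3 where
  one_smul p := by
    apply ext'
    · simp [smul_z, num, den]
    · simp [smul_t, den]
  mul_smul g h p := by
    have h1 : (den h p : ℂ) ≠ 0 := by exact_mod_cast (den_pos h p).ne'
    have h2 := (den_pos h p).ne'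
    apply ext'
    · rw [smul_z, smul_z, den_mul, num_mul]
      push_cast
      rw [mul_div_mul_right _ _ h1]
    · rw [smul_t, smul_t, smul_t, den_mul, mul_comm, div_div]

/-- Scalar matrices act trivially. -/
theorem center_smul (g : SL(2, ℂ)) (hg : g ∈ Subgroup.center SL(2, ℂ)) (p : H3) : g • p = p := by
  obtain ⟨r, hr, hs⟩ := Matrix.SpecialLinearGroup.mem_center_iff.mp hg
  have e : ∀ i j, g i j = Matrix.scalar (Fin 2) r i j := fun i j => by rw [hs]
  have hr2 : r * r = 1 := by simpa [sq] using hr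
  have hn : Complex.normSq r = 1 := by
    have h := congrArg Complex.normSq hr2
    rw [map_mul, map_one] at h
    nlinarith [Complex.normSq_nonneg r]
  have hn' : r * conj r = 1 := by rw [Complex.mul_conj, hn]; simp
  apply ext'
  · rw [smul_z]
    simp only [num, den, e]
    simp [hn]
    linear_combination p.z * hn'
  · rw [smul_t]
    simp only [den, e]
    simp [hn]

end H3

/-- `PSL₂(ℂ) = SL₂(ℂ) / {± 1}`, the group of orientation-preserving isometries of `ℍ³`. -/
abbrev PSL2C : Type := Matrix.ProjectiveSpecialLinearGroup (Fin 2) ℂ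

/-- The action of `PSL₂(ℂ)` on `ℍ³`, as a homomorphism to permutations. -/
def toPerm : PSL2C →* Equiv.Perm H3 :=
  QuotientGroup.lift (Subgroup.center SL(2, ℂ)) (MulAction.toPermHom SL(2, ℂ) H3)
    (fun g hg => Equiv.ext fun p => H3.center_smul g hg p)

instance : MulAction PSL2C H3 := MulAction.compHom H3 toPerm

theorem mk_smul (g : SL(2, ℂ)) (p : H3) : (QuotientGroup.mk g : PSL2C) • p = g • p := rfl

/-- The quotient `ℍ³ / Γ`. -/
abbrev HypQuot (Γ : Subgroup PSL2C) : Type := MulAction.orbitRel.Quotient Γ H3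

/-- The projection `ℍ³ → ℍ³ / Γ`. -/
def proj (Γ : Subgroup PSL2C) (p : H3) : HypQuot Γ := Quotient.mk _ p

/-- The hyperbolic volume of a subset `A` of `ℍ³ / Γ` (with `Γ` discrete and torsion-free, so that
`ℍ³ → ℍ³ / Γ` is a local isometry): the least volume of a measurable subset of `ℍ³` whose
projection covers `A`. For a Borel set `A` it is the volume of the part over `A` of any measurable
fundamental domain of `Γ`. -/
def vol (Γ : Subgroup PSL2C) (A : Set (HypQuot Γ)) : ℝ≥0∞ :=
  ⨅ (D : Set H3) (_ : MeasurableSet D) (_ : A ⊆ proj Γ '' D), MeasureTheory.volume D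

/-- `B` is an embedded (open) ball in `ℍ³ / Γ`: the homeomorphic, locally isometric image of a
hyperbolic ball of positive radius under the projection. -/
def IsEmbeddedBall (Γ : Subgroup PSL2C) (B : Set (HypQuot Γ)) : Prop :=
  ∃ (p : H3) (r : ℝ), 0 < r ∧ Set.InjOn (proj Γ) (H3.ball p r) ∧ B = proj Γ '' H3.ball p r

/-- `Γ` is torsion-free. -/
def IsTorsionFree (Γ : Subgroup PSL2C) : Prop := ∀ γ ∈ Γ, IsOfFinOrder γ → γ = 1

section Bianchi

variable {K : Type*} [Field K]

/-- The map `SL₂(𝓞_K) → PSL₂(ℂ)` given by a complex embedding `φ` of `K`; its kernel is `{± 1}`. -/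
def toPSL2C (φ : K →+* ℂ) : SL(2, 𝓞 K) →* PSL2C :=
  (QuotientGroup.mk' (Subgroup.center SL(2, ℂ))).comp
    (Matrix.SpecialLinearGroup.map (φ.comp (algebraMap (𝓞 K) K)))

/-- The Bianchi group `PSL₂(𝓞_K)`, as a subgroup of `PSL₂(ℂ)`. -/
def bianchi (φ : K →+* ℂ) : Subgroup PSL2C := (toPSL2C φ).range

/-- Reduction of matrices modulo `I`. -/
def red (I : Ideal (𝓞 K)) : SL(2, 𝓞 K) →* SL(2, 𝓞 K ⧸ I) :=
  Matrix.SpecialLinearGroup.map (Ideal.Quotient.mk I)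

/-- The matrices in `SL₂(𝓞_K)` congruent to `(* * ; 0 *)` modulo `I`. -/
def hecke0 (I : Ideal (𝓞 K)) : Subgroup SL(2, 𝓞 K) where
  carrier := {g | red I g 1 0 = 0}
  one_mem' := by simp
  mul_mem' := by
    intro g h hg hh
    simp only [Set.mem_ofPred_eq] at *
    rw [map_mul]
    simp [Matrix.mul_apply, Fin.sum_univ_two, hg, hh]
  inv_mem' := by
    intro g hg
    simp only [Set.mem_ofPred_eq] at *
    rw [map_inv, Matrix.SpecialLinearGroup.coe_inv, Matrix.adjugate_fin_two]
    simp [hg]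

/-- The matrices in `SL₂(𝓞_K)` congruent to `± (1 * ; 0 1)` modulo `I`. -/
def hecke1 (I : Ideal (𝓞 K)) : Subgroup SL(2, 𝓞 K) where
  carrier := {g | red I g 1 0 = 0 ∧
    ((red I g 0 0 = 1 ∧ red I g 1 1 = 1) ∨ (red I g 0 0 = -1 ∧ red I g 1 1 = -1))}
  one_mem' := by simp
  mul_mem' := by
    rintro g h ⟨hg, hg'⟩ ⟨hh, hh'⟩
    simp only [Set.mem_ofPred_eq]
    rw [map_mul]
    rcases hg' with ⟨h1, h2⟩ | ⟨h1, h2⟩ <;> rcases hh' with ⟨h3, h4⟩ | ⟨h3, h4⟩ <;>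
      simp [Matrix.mul_apply, Fin.sum_univ_two, hg, hh, h1, h2, h3, h4]
  inv_mem' := by
    rintro g ⟨hg, hg'⟩
    simp only [Set.mem_ofPred_eq]
    rw [map_inv, Matrix.SpecialLinearGroup.coe_inv, Matrix.adjugate_fin_two]
    rcases hg' with ⟨h1, h2⟩ | ⟨h1, h2⟩ <;> simp [hg, h1, h2]

/-- The matrices in `SL₂(𝓞_K)` congruent to `± 1` modulo `I`. -/
def principal (I : Ideal (𝓞 K)) : Subgroup SL(2, 𝓞 K) where
  carrier := {g | red I g = 1 ∨ red I g = -1}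
  one_mem' := by simp
  mul_mem' := by
    rintro g h (hg | hg) (hh | hh) <;> simp [hg, hh]
  inv_mem' := by
    rintro g (hg | hg) <;> simp [hg]

/-- The Hecke-type congruence subgroup `Γ₀(I)` of a subgroup `Γ` of the Bianchi group. -/
def Gamma0 (φ : K →+* ℂ) (Γ : Subgroup PSL2C) (I : Ideal (𝓞 K)) : Subgroup PSL2C :=
  Γ ⊓ (hecke0 I).map (toPSL2C φ)

/-- The Hecke-type congruence subgroup `Γ₁(I)` of a subgroup `Γ` of the Bianchi group. -/
def Gamma1 (φ : K →+* ℂ) (Γ : Subgroup PSL2C) (I : Ideal (𝓞 K)) : Subgroup PSL2C :=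
  Γ ⊓ (hecke1 I).map (toPSL2C φ)

/-- The principal congruence subgroup `Γ(I)` of a subgroup `Γ` of the Bianchi group: the kernel of
`Γ → SL₂(𝓞_K / I) / {± 1}`. -/
def GammaP (φ : K →+* ℂ) (Γ : Subgroup PSL2C) (I : Ideal (𝓞 K)) : Subgroup PSL2C :=
  Γ ⊓ (principal I).map (toPSL2C φ)

end Bianchi

end HypThree

end

/-! The larger a cover is, the farther a well-chosen point of its universal cover is moved by the
deck group, and both sizes are governed by the norm `N` of `I`. A matrix with entries a, b, c, d
moves the point at height t on the axis by a distance D with 2 cosh D = |a|² + |d|² + |b|²/t² +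
|c|²t² (`twoCosh_smul_axis`). Since K has a single, complex place, |x|² is the ideal norm of (x); it
is at least 1 for x ≠ 0, and at least `N` if moreover x lies in I (`absNorm_le_normSq`). A
nontrivial element of a torsion-free group has b ≠ 0 or c ≠ 0.

For Γ₀(I), hence for Γ₁(I), c lies in I, and t² = 1/√N gives displacement 2 cosh D ≥ √N. For Γ(I)
both b and c lie in I, and t = 1 gives 2 cosh D ≥ N.

If 2 cosh D ≥ X for all nontrivial deck elements, a ball with 2 cosh r = √X embeds, and its volume
is at least πX/64 (`exists_embeddedBall`). On the other side, the volume of the cover is at most its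
degree times a constant, and the degrees are O(N^(1+η)), at most N² and at most N³ in the three
cases. Comparing √N, √N, N with these bounds gives the exponents 1/2 - ε, 1/4, 1/3. The same degree
bounds show that a large degree forces a large `N`. -/

open MeasureTheory

namespace HypThree

/-! ### Displacement in hyperbolic space, measured by twice the hyperbolic cosine. -/

namespace H3

/-- Twice the hyperbolic cosine of the hyperbolic distance. -/
noncomputable def twoCosh (p q : H3) : ℝ :=
  (Complex.normSq (p.z - q.z) + p.t ^ 2 + q.t ^ 2) / (p.t * q.t)

theorem twoCosh_comm (p q : H3) : twoCosh p q = twoCosh q p := by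
  unfold twoCosh
  rw [← Complex.normSq_neg (p.z - q.z), neg_sub, mul_comm p.t q.t]
  ring

theorem two_le_twoCosh (p q : H3) : 2 ≤ twoCosh p q := by
  have hp := p.t_pos
  have hq := q.t_pos
  unfold twoCosh
  rw [le_div_iff₀ (by positivity)]
  nlinarith [Complex.normSq_nonneg (p.z - q.z), sq_nonneg (p.t - q.t)]

theorem twoCosh_pos (p q : H3) : 0 < twoCosh p q := by linarith [two_le_twoCosh p q]

theorem eq_of_twoCosh_le_two {p q : H3} (h : twoCosh p q ≤ 2) : p = q := by
  have hp := p.t_pos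
  have hq := q.t_pos
  unfold twoCosh at h
  rw [div_le_iff₀ (by positivity)] at h
  have h1 := Complex.normSq_nonneg (p.z - q.z)
  have h2 := sq_nonneg (p.t - q.t)
  have h3 : Complex.normSq (p.z - q.z) = 0 := by nlinarith
  have h4 : (p.t - q.t) ^ 2 = 0 := by nlinarith
  exact ext' (sub_eq_zero.mp (Complex.normSq_eq_zero.mp h3))
    (sub_eq_zero.mp (pow_eq_zero_iff two_ne_zero |>.mp h4))

/-- A multiplicative triangle inequality: 2 cosh(x + y) ≤ (2 cosh x)(2 cosh y). It loses at most a
constant factor against the true triangle inequality, which does not affect the exponents. -/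
theorem twoCosh_mul_le (p q r : H3) : twoCosh p r ≤ twoCosh p q * twoCosh q r := by
  have hp := p.t_pos
  have hq := q.t_pos
  have hr := r.t_pos
  have h := norm_sub_le_norm_sub_add_norm_sub p.z q.z r.z
  simp only [twoCosh, Complex.normSq_eq_norm_sq]
  rw [div_mul_div_comm, div_le_div_iff₀ (by positivity) (by positivity)]
  set x := ‖p.z - q.z‖
  set y := ‖q.z - r.z‖
  set w := ‖p.z - r.z‖
  have hw : 0 ≤ w := norm_nonneg _
  have hw2 : w ^ 2 ≤ (x + y) ^ 2 := by gcongr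
  -- After expansion, the cross term 2xy·t² with t = `q.t` is absorbed by (xy - t²)² ≥ 0.
  have key : (w ^ 2 + p.t ^ 2 + r.t ^ 2) * q.t ^ 2 ≤
      (x ^ 2 + p.t ^ 2 + q.t ^ 2) * (y ^ 2 + q.t ^ 2 + r.t ^ 2) := by
    nlinarith [mul_le_mul_of_nonneg_right hw2 (sq_nonneg q.t), sq_nonneg (x * y - q.t ^ 2),
      sq_nonneg (x * r.t), sq_nonneg (p.t * y), sq_nonneg (p.t * r.t)]
  calc _ = ((w ^ 2 + p.t ^ 2 + r.t ^ 2) * q.t ^ 2) * (p.t * r.t) := by ring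
    _ ≤ _ := by
      rw [mul_comm (_ * _) (p.t * r.t), mul_comm (_ * _) (p.t * r.t)]
      gcongr

theorem twoCosh_smul (g : SL(2, ℂ)) (p q : H3) : twoCosh (g • p) (g • q) = twoCosh p q := by
  have hp := p.t_pos.ne'
  have hq := q.t_pos.ne'
  have hDp := (den_pos g p).ne'
  have hDq := (den_pos g q).ne'
  have hp' : (p.t : ℂ) ≠ 0 := by exact_mod_cast hp
  have hq' : (q.t : ℂ) ≠ 0 := by exact_mod_cast hq
  have hDp' : (den g p : ℂ) ≠ 0 := by exact_mod_cast hDp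
  have hDq' : (den g q : ℂ) ≠ 0 := by exact_mod_cast hDq
  have kp := key_norm g p
  have kq := key_norm g q
  have h := det_eq g
  have h' : conj (g 0 0) * conj (g 1 1) - conj (g 0 1) * conj (g 1 0) = 1 := by
    simpa using congrArg conj h
  -- This is the polarised form of `key_norm`, which is half of the case p = q.
  have main : ((g 0 0 * p.z + g 0 1) * conj (g 0 0 * p.z + g 0 1)
        + g 0 0 * conj (g 0 0) * (p.t : ℂ) ^ 2) * den g q +
      ((g 0 0 * q.z + g 0 1) * conj (g 0 0 * q.z + g 0 1)
        + g 0 0 * conj (g 0 0) * (q.t : ℂ) ^ 2) * den g p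
      - num g p * conj (num g q) - num g q * conj (num g p) =
      (p.z - q.z) * conj (p.z - q.z) + p.t ^ 2 + q.t ^ 2 := by
    rw [den_coe, den_coe]
    simp only [num, map_add, map_sub, map_mul, map_pow, Complex.conj_conj, Complex.conj_ofReal]
    linear_combination ((p.z - q.z) * (conj p.z - conj q.z) + (p.t : ℂ) ^ 2 + q.t ^ 2) *
      (h + (g 0 0 * g 1 1 - g 0 1 * g 1 0) * h')
  apply Complex.ofReal_injective
  unfold twoCosh
  push_cast
  rw [← Complex.mul_conj, ← Complex.mul_conj, smul_z, smul_z, smul_t, smul_t]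
  push_cast
  rw [div_eq_div_iff (by positivity) (by positivity)]
  simp only [map_sub, map_div₀, Complex.conj_ofReal] at main ⊢
  rw [← main]
  field_simp
  linear_combination (den g q : ℂ) ^ 2 * kp + (den g p : ℂ) ^ 2 * kq

theorem dist_lt_iff {p q : H3} {r : ℝ} (hr : 0 < r) :
    dist p q < r ↔ twoCosh p q < 2 * Real.cosh r := by
  have hp := p.t_pos
  have hq := q.t_pos
  have e : 1 + (‖p.z - q.z‖ ^ 2 + (p.t - q.t) ^ 2) / (2 * p.t * q.t) = twoCosh p q / 2 := by
    rw [twoCosh, Complex.normSq_eq_norm_sq]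
    field_simp
    ring
  have h2 := two_le_twoCosh p q
  unfold dist
  rw [e, ← Real.arcosh_cosh hr.le, Real.arcosh_lt_arcosh (by linarith) (Real.cosh_pos _),
    Real.arcosh_cosh hr.le]
  constructor <;> intro h <;> linarith

/-- The point `t j` on the vertical axis. -/
def axis (t : ℝ) (ht : 0 < t) : H3 := ⟨(0, t), ht⟩

/-- At t = 1 this is the squared Frobenius norm of the matrix; changing t amounts to conjugating by
a diagonal matrix, which lets one trade b against c. -/
theorem twoCosh_smul_axis (g : SL(2, ℂ)) {t : ℝ} (ht : 0 < t) :
    twoCosh (g • axis t ht) (axis t ht) =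
      Complex.normSq (g 0 0) + Complex.normSq (g 1 1) + Complex.normSq (g 0 1) / t ^ 2 +
        Complex.normSq (g 1 0) * t ^ 2 := by
  have hz : (axis t ht).z = 0 := rfl
  have htt : (axis t ht).t = t := rfl
  have hD := (den_pos g (axis t ht)).ne'
  have hD' : (den g (axis t ht) : ℂ) ≠ 0 := by exact_mod_cast hD
  have ht' : (t : ℂ) ≠ 0 := by exact_mod_cast ht.ne'
  have k := key_norm g (axis t ht)
  have hd := den_coe g (axis t ht)
  apply Complex.ofReal_injective
  unfold twoCosh
  push_cast
  rw [← Complex.mul_conj, ← Complex.mul_conj, ← Complex.mul_conj, ← Complex.mul_conj,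
    ← Complex.mul_conj, smul_z, smul_t]
  rw [hz, htt] at k hd ⊢
  simp only [mul_zero, zero_add, map_div₀, sub_zero, Complex.conj_ofReal] at k hd ⊢
  push_cast
  field_simp
  linear_combination k + (den g (axis t ht) : ℂ) * t ^ 2 * hd

end H3
end HypThree

/-! ### Invariance of hyperbolic volume under Möbius transformations. -/

namespace HypThree

namespace H3

/-- The coordinates `(z, t)` of a point of `ℍ³`. -/
def coords (p : H3) : ℂ × ℝ := (p.z, p.t)

theorem coords_injective : Function.Injective coords := Subtype.val_injective

theorem measurableEmbedding_coords : MeasurableEmbedding coords :=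
  MeasurableEmbedding.subtype_coe (measurableSet_lt measurable_const measurable_snd)

theorem volume_eq_lintegral {s : Set H3} (hs : MeasurableSet s) :
    volume s = ∫⁻ x in coords '' s, ENNReal.ofReal (1 / x.2 ^ 3) := by
  have e := measurableEmbedding_coords
  have h1 : volume s = ∫⁻ p in s, ENNReal.ofReal (1 / (coords p).2 ^ 3)
      ∂((volume : Measure (ℂ × ℝ)).comap coords) :=
    withDensity_apply _ hs
  have hm := e.measurableSet_image.mpr hs
  rw [h1]
  have h2 := setLIntegral_map (μ := (volume : Measure (ℂ × ℝ)).comap coords) hm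
    (f := fun x => ENNReal.ofReal (1 / x.2 ^ 3)) (by fun_prop) e.measurable
  rw [Set.preimage_image_eq _ coords_injective] at h2
  rw [← h2, e.map_comap, Measure.restrict_restrict hm,
    Set.inter_eq_left.mpr (Set.image_subset_range _ _)]

theorem measurable_smul (g : SL(2, ℂ)) : Measurable (fun p : H3 => g • p) := by
  have hz : Measurable (fun p : H3 => p.z) := measurable_fst.comp measurable_subtype_coe
  have ht : Measurable (fun p : H3 => p.t) := measurable_snd.comp measurable_subtype_coe
  have hd : Measurable (fun p : H3 => den g p) := by
    unfold den
    exact ((Complex.continuous_normSq.measurable.comp ((hz.const_mul _).add_const _))).add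
      ((ht.pow_const 2).const_mul _)
  have hn : Measurable (fun p : H3 => num g p) := by
    unfold num
    exact (((hz.const_mul _).add_const _).mul
      (Complex.continuous_conj.measurable.comp ((hz.const_mul _).add_const _))).add
        (((Complex.measurable_ofReal.comp ht).pow_const 2).const_mul _)
  exact ((hn.div (Complex.measurable_ofReal.comp hd)).prodMk (ht.div hd)).subtype_mk

theorem image_smul_eq_preimage (g : SL(2, ℂ)) (s : Set H3) :
    (fun p : H3 => g • p) '' s = (fun p : H3 => g⁻¹ • p) ⁻¹' s := by
  ext x
  constructor
  · rintro ⟨y, hy, rfl⟩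
    simpa using hy
  · intro hx
    exact ⟨g⁻¹ • x, hx, by simp⟩

theorem measurableSet_image_smul (g : SL(2, ℂ)) {s : Set H3} (hs : MeasurableSet s) :
    MeasurableSet ((fun p : H3 => g • p) '' s) := by
  rw [image_smul_eq_preimage]
  exact measurable_smul _ hs

/-- Invariance of the volume under a map which is given in coordinates by a differentiable map `T`
with Jacobian determinant `(t (T x) / t x) ^ 3`. -/
theorem volume_image_eq_of_hasFDerivAt {f : H3 → H3} (hf : f.Injective)
    (hfm : ∀ s, MeasurableSet s → MeasurableSet (f '' s)) (T : ℂ × ℝ → ℂ × ℝ)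
    (T' : ℂ × ℝ → (ℂ × ℝ →L[ℝ] ℂ × ℝ)) (hT : ∀ p : H3, coords (f p) = T (coords p))
    (hT' : ∀ p : H3, HasFDerivAt T (T' (coords p)) (coords p))
    (hdet : ∀ p : H3, |(T' (coords p)).det| = ((f p).t / p.t) ^ 3)
    {s : Set H3} (hs : MeasurableSet s) :
    volume (f '' s) = volume s := by
  have him : coords '' (f '' s) = T '' (coords '' s) := by
    rw [Set.image_image, Set.image_image]
    exact Set.image_congr fun p _ => hT p
  have hms := measurableEmbedding_coords.measurableSet_image.mpr hs
  have hinj : Set.InjOn T (coords '' s) := by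
    rintro _ ⟨p, _, rfl⟩ _ ⟨q, _, rfl⟩ h
    rw [← hT, ← hT] at h
    rw [hf (coords_injective h)]
  have : (volume : Measure (ℂ × ℝ)).IsAddHaarMeasure := Measure.prod.instIsAddHaarMeasure _ _
  rw [volume_eq_lintegral hs, volume_eq_lintegral (hfm s hs), him,
    lintegral_image_eq_lintegral_abs_det_fderiv_mul (volume : Measure (ℂ × ℝ)) hms
      (f' := T') (by rintro _ ⟨p, _, rfl⟩; exact (hT' p).hasFDerivWithinAt) hinj]
  refine setLIntegral_congr_fun hms ?_
  rintro _ ⟨p, _, rfl⟩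
  have h1 := p.t_pos
  have h2 := (f p).t_pos
  have e1 : (T (coords p)).2 = (f p).t := by rw [← hT]; rfl
  have e2 : (coords p).2 = p.t := rfl
  simp only []
  rw [hdet, e1, e2, ← ENNReal.ofReal_mul (by positivity)]
  congr 1
  field_simp

theorem det_mul_complex (u : ℂ) :
    LinearMap.det (LinearMap.mulLeft ℝ u) = Complex.normSq u := by
  rw [← Algebra.norm_complex_apply, Algebra.norm_apply]
  rfl

/-- In coordinates the map is z ↦ a²z + ab, t ↦ |a|²t, with Jacobian |a|⁴·|a|² = (|a|²)³. -/
theorem volume_image_smul_of_lower_eq_zero (g : SL(2, ℂ)) (hg : g 1 0 = 0) {s : Set H3}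
    (hs : MeasurableSet s) : volume ((fun p : H3 => g • p) '' s) = volume s := by
  have hdet : g 0 0 * g 1 1 = 1 := by simpa [hg] using det_eq g
  have hn : Complex.normSq (g 0 0) * Complex.normSq (g 1 1) = 1 := by
    rw [← map_mul, hdet, map_one]
  have hd : ∀ p, den g p = Complex.normSq (g 1 1) := fun p => by simp [den, hg]
  have h1 : Complex.normSq (g 1 1) ≠ 0 := right_ne_zero_of_mul_eq_one hn
  have h1' : (Complex.normSq (g 1 1) : ℂ) ≠ 0 := by exact_mod_cast h1
  have hn' : (Complex.normSq (g 0 0) : ℂ) * Complex.normSq (g 1 1) = 1 := by exact_mod_cast hn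
  have h0 : ∀ x : ℝ, x / Complex.normSq (g 1 1) = Complex.normSq (g 0 0) * x := fun x => by
    rw [div_eq_iff h1]; linear_combination (-x) * hn
  let L : ℂ × ℝ →L[ℝ] ℂ × ℝ := LinearMap.toContinuousLinearMap
    ((LinearMap.mulLeft ℝ (g 0 0 ^ 2)).prodMap (LinearMap.mulLeft ℝ (Complex.normSq (g 0 0))))
  refine volume_image_eq_of_hasFDerivAt (MulAction.injective g)
    (fun s hs => measurableSet_image_smul g hs)
    (fun x => L x + (g 0 0 * g 0 1, 0)) (fun _ => L) ?_
    (fun p => L.hasFDerivAt.add_const _) ?_ hs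
  · intro p
    have e2 : (g • p).t = Complex.normSq (g 0 0) * p.t := by rw [smul_t, hd, h0]
    have e1 : (g • p).z = g 0 0 ^ 2 * p.z + g 0 0 * g 0 1 := by
      rw [smul_z, hd, div_eq_iff h1']
      simp only [num, hg, zero_mul, zero_add, map_zero, mul_zero, add_zero]
      rw [← Complex.mul_conj]
      linear_combination (-(g 0 0 * p.z + g 0 1) * conj (g 1 1)) * hdet
    simp only [coords, e1, e2]
    ext <;> simp [L]
  · intro p
    have : L.det = Complex.normSq (g 0 0 ^ 2) * Complex.normSq (g 0 0) := by
      rw [ContinuousLinearMap.det, LinearMap.coe_toContinuousLinearMap, LinearMap.det_prodMap,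
        det_mul_complex]
      simp
    rw [this, map_pow, smul_t, hd, h0, mul_div_assoc, div_self p.t_pos.ne', mul_one, abs_of_nonneg]
    · ring
    · have := Complex.normSq_nonneg (g 0 0)
      positivity

/-- The matrix `(0 -1; 1 0)`. -/
def invol : SL(2, ℂ) := ⟨!![0, -1; 1, 0], by simp [Matrix.det_fin_two]⟩

/-- The map is inversion in the unit sphere followed by z ↦ -conj z. The derivative of the inversion
at x is a reflection scaled by |x|⁻², so in dimension 3 the Jacobian is |x|⁻⁶. -/
theorem volume_image_smul_invol {s : Set H3} (hs : MeasurableSet s) :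
    volume ((fun p : H3 => invol • p) '' s) = volume s := by
  have hd : ∀ p, den invol p = Complex.normSq p.z + p.t ^ 2 := fun p => by simp [den, invol]
  have hnum : ∀ p, num invol p = - conj p.z := fun p => by simp [num, invol]
  -- The product carries the sup norm, so inversion has to be carried out in the Euclidean space
  -- `WithLp 2 (ℂ × ℝ)`.
  let e : (ℂ × ℝ) ≃L[ℝ] WithLp 2 (ℂ × ℝ) := (WithLp.prodContinuousLinearEquiv 2 ℝ ℂ ℝ).symm
  let R : ℂ × ℝ →L[ℝ] ℂ × ℝ := LinearMap.toContinuousLinearMap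
    ((-Complex.conjAe.toLinearMap).prodMap LinearMap.id)
  let D : WithLp 2 (ℂ × ℝ) → (WithLp 2 (ℂ × ℝ) →L[ℝ] WithLp 2 (ℂ × ℝ)) := fun x =>
    (1 / Dist.dist x 0) ^ 2 • ((Submodule.span ℝ {x - 0})ᗮ.reflection :
      WithLp 2 (ℂ × ℝ) →L[ℝ] WithLp 2 (ℂ × ℝ))
  have hnorm : ∀ p : H3, Dist.dist (e (coords p)) 0 ^ 2 = Complex.normSq p.z + p.t ^ 2 := fun p => by
    rw [dist_zero_right, WithLp.prod_norm_sq_eq_of_L2, Complex.normSq_eq_norm_sq]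
    simp [e, coords]
  have hpos : ∀ p : H3, 0 < Complex.normSq p.z + p.t ^ 2 := fun p => by
    rw [← hd]; exact den_pos _ _
  refine volume_image_eq_of_hasFDerivAt (MulAction.injective invol)
    (fun s hs => measurableSet_image_smul invol hs)
    (fun x => R (e.symm (EuclideanGeometry.inversion 0 1 (e x))))
    (fun x => R.comp ((e.symm : WithLp 2 (ℂ × ℝ) →L[ℝ] ℂ × ℝ).comp ((D (e x)).comp
      (e : ℂ × ℝ →L[ℝ] WithLp 2 (ℂ × ℝ))))) ?_ ?_ ?_ hs
  · intro p
    have : EuclideanGeometry.inversion 0 1 (e (coords p)) =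
        (Complex.normSq p.z + p.t ^ 2)⁻¹ • e (coords p) := by
      rw [← hnorm]
      simp [EuclideanGeometry.inversion]
    rw [this, map_smul, e.symm_apply_apply, map_smul]
    have e1 : coords (invol • p) = ((invol • p).z, (invol • p).t) := rfl
    rw [e1, smul_z, smul_t, hd, hnum]
    ext
    · simp [R, coords, div_eq_inv_mul]
    · simp [R, coords, div_eq_inv_mul]
  · intro p
    have hne : e (coords p) ≠ 0 := by
      intro h
      have := hnorm p
      rw [h, dist_self] at this
      linarith [hpos p]
    exact R.hasFDerivAt.comp _ ((e.symm : WithLp 2 (ℂ × ℝ) →L[ℝ] ℂ × ℝ).hasFDerivAt.comp _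
      ((EuclideanGeometry.hasFDerivAt_inversion hne).comp _
        (e : ℂ × ℝ →L[ℝ] WithLp 2 (ℂ × ℝ)).hasFDerivAt))
  · intro p
    have h1 : LinearMap.det (R : ℂ × ℝ →ₗ[ℝ] ℂ × ℝ) = -1 := by
      rw [LinearMap.coe_toContinuousLinearMap, LinearMap.det_prodMap, LinearMap.det_id, mul_one, ← neg_one_smul ℝ,
        LinearMap.det_smul, Complex.finrank_real_complex, Complex.det_conjAe]
      norm_num
    have h3 : Module.finrank ℝ (WithLp 2 (ℂ × ℝ)) = 3 := by
      rw [← e.toLinearEquiv.finrank_eq, Module.finrank_prod, Complex.finrank_real_complex,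
        Module.finrank_self]
    have h2 : |LinearMap.det (D (e (coords p)) : WithLp 2 (ℂ × ℝ) →ₗ[ℝ] WithLp 2 (ℂ × ℝ))| =
        (Complex.normSq p.z + p.t ^ 2)⁻¹ ^ 3 := by
      change |LinearMap.det (((1 / Dist.dist (e (coords p)) 0) ^ 2) •
        (Submodule.span ℝ {e (coords p) - 0})ᗮ.reflection.toLinearMap)| = _
      rw [LinearMap.det_smul, Submodule.det_reflection, h3, abs_mul, abs_pow, abs_pow, sq_abs,
        abs_neg_one_pow, mul_one, one_div, inv_pow, hnorm]
    change |LinearMap.det ((R : ℂ × ℝ →ₗ[ℝ] ℂ × ℝ) ∘ₗ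
      ((e.toLinearEquiv.symm : WithLp 2 (ℂ × ℝ) →ₗ[ℝ] ℂ × ℝ) ∘ₗ
        (D (e (coords p)) : WithLp 2 (ℂ × ℝ) →ₗ[ℝ] WithLp 2 (ℂ × ℝ)) ∘ₗ
          (e.toLinearEquiv.symm.symm : ℂ × ℝ →ₗ[ℝ] WithLp 2 (ℂ × ℝ))))| = _
    rw [LinearMap.det_comp, h1, LinearMap.det_conj, abs_mul, h2, smul_t, hd, abs_neg, abs_one,
      one_mul, div_div_cancel_left' p.t_pos.ne']

/-- By the Bruhat decomposition, a matrix with c ≠ 0 is upper triangular times `invol` times upper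
triangular. -/
theorem volume_image_smul (g : SL(2, ℂ)) {s : Set H3} (hs : MeasurableSet s) :
    volume ((fun p : H3 => g • p) '' s) = volume s := by
  by_cases hc : g 1 0 = 0
  · exact volume_image_smul_of_lower_eq_zero g hc hs
  let u : SL(2, ℂ) := ⟨!![1, g 0 0 / g 1 0; 0, 1], by simp [Matrix.det_fin_two]⟩
  let v : SL(2, ℂ) := ⟨!![g 1 0, g 1 1; 0, 1 / g 1 0], by simp [Matrix.det_fin_two, hc]⟩
  have hg : g = u * invol * v := by
    have hdet := det_eq g
    apply Subtype.ext
    change g.1 = !![1, g 0 0 / g 1 0; 0, 1] * !![0, -1; 1, 0] * !![g 1 0, g 1 1; 0, 1 / g 1 0]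
    ext i j
    fin_cases i <;> fin_cases j <;> simp [hc]
    field_simp
    linear_combination -hdet
  have himg : (fun p : H3 => g • p) '' s =
      (fun p : H3 => u • p) '' ((fun p : H3 => invol • p) '' ((fun p : H3 => v • p) '' s)) := by
    rw [Set.image_image, Set.image_image, hg]
    simp only [mul_smul]
  have hv := measurableSet_image_smul v hs
  rw [himg, volume_image_smul_of_lower_eq_zero u (by simp [u]) (measurableSet_image_smul _ hv),
    volume_image_smul_invol hv, volume_image_smul_of_lower_eq_zero v (by simp [v]) hs]

end H3
end HypThree

/-! ### Volumes of balls and of quotients; embedded balls from large displacement. -/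

namespace HypThree

namespace H3

theorem ball_eq {p : H3} {r : ℝ} (hr : 0 < r) : ball p r = {q | twoCosh p q < 2 * Real.cosh r} :=
  Set.ext fun _ => dist_lt_iff hr

theorem measurableSet_ball (p : H3) {r : ℝ} (hr : 0 < r) : MeasurableSet (ball p r) := by
  have hz : Measurable (fun p : H3 => p.z) := measurable_fst.comp measurable_subtype_coe
  have ht : Measurable (fun p : H3 => p.t) := measurable_snd.comp measurable_subtype_coe
  rw [ball_eq hr]
  refine measurableSet_lt ?_ measurable_const
  unfold twoCosh
  exact (((Complex.continuous_normSq.measurable.comp (hz.const_sub _)).add_const _).add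
    (ht.pow_const 2)).div (ht.const_mul _)

/-- The hyperbolic ball contains the cylinder over the disc of radius `t / √2` with heights between
`t / cosh r` and `2 t / cosh r`. -/
theorem volume_ball_ge (p : H3) {r : ℝ} (hr : 0 < r) (h8 : 8 ≤ Real.cosh r ^ 2) :
    ENNReal.ofReal (Real.pi / 16 * Real.cosh r ^ 2) ≤ volume (ball p r) := by
  have ht := p.t_pos
  have hC := Real.cosh_pos r
  set C := Real.cosh r with hCdef
  set a := p.t / C with ha
  have hapos : 0 < a := by positivity
  set ρ := p.t / √2 with hρ
  have hρ2 : ρ ^ 2 = p.t ^ 2 / 2 := by rw [hρ, div_pow, Real.sq_sqrt (by norm_num)]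
  have hρpos : 0 < ρ := by positivity
  have htC : p.t = a * C := by rw [ha]; field_simp
  set box : Set (ℂ × ℝ) := Metric.ball p.z ρ ×ˢ Set.Ioc a (2 * a) with hbox
  have hboxm : MeasurableSet box :=
    MeasurableSet.prod Metric.isOpen_ball.measurableSet measurableSet_Ioc
  have hsm : MeasurableSet (coords ⁻¹' box) := measurableEmbedding_coords.measurable hboxm
  have hsub : coords ⁻¹' box ⊆ ball p r := by
    rintro q ⟨h1, h2⟩
    have hq := q.t_pos
    change q.z ∈ Metric.ball p.z ρ at h1
    change a < q.t ∧ q.t ≤ 2 * a at h2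
    rw [Metric.mem_ball, dist_comm, dist_eq_norm] at h1
    have h3 : Complex.normSq (p.z - q.z) < p.t ^ 2 / 2 := by
      rw [Complex.normSq_eq_norm_sq, ← hρ2]
      gcongr
    rw [ball_eq hr]
    change twoCosh p q < 2 * C
    unfold twoCosh
    rw [div_lt_iff₀ (by positivity)]
    have h4 : q.t ^ 2 ≤ 4 * a ^ 2 := by nlinarith
    -- The bound cosh² r ≥ 8 puts the top 2a of the cylinder below `p.t / √2`, so the numerator of
    -- `twoCosh p q` stays under 2 `p.t`².
    have h5 : 4 * a ^ 2 ≤ p.t ^ 2 / 2 := by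
      rw [htC, mul_pow]; nlinarith [sq_nonneg a]
    have h6 : 2 * p.t ^ 2 < 2 * C * (p.t * q.t) := by
      have : p.t < C * q.t := by rw [htC]; nlinarith
      nlinarith
    nlinarith
  have himg : coords '' (coords ⁻¹' box) = box := by
    rw [Set.image_preimage_eq_iff]
    rintro ⟨z, s⟩ ⟨_, h2⟩
    exact ⟨⟨(z, s), hapos.trans h2.1⟩, rfl⟩
  have hvol : volume box = ENNReal.ofReal (Real.pi * ρ ^ 2 * a) := by
    rw [hbox, Measure.volume_eq_prod, Measure.prod_prod, Complex.volume_ball, Real.volume_Ioc,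
      ← ENNReal.ofReal_pow hρpos.le, ← NNReal.coe_real_pi, ← ENNReal.ofReal_coe_nnreal,
      ← ENNReal.ofReal_mul (by positivity), ← ENNReal.ofReal_mul (by positivity)]
    congr 1
    ring
  calc ENNReal.ofReal (Real.pi / 16 * C ^ 2)
      = ENNReal.ofReal (1 / (2 * a) ^ 3) * volume box := by
        rw [hvol, ← ENNReal.ofReal_mul (by positivity)]
        congr 1
        rw [hρ2, htC]
        field_simp
        norm_num
    _ = ∫⁻ _ in box, ENNReal.ofReal (1 / (2 * a) ^ 3) := (setLIntegral_const _ _).symm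
    _ ≤ ∫⁻ x in box, ENNReal.ofReal (1 / x.2 ^ 3) := by
        refine setLIntegral_mono' hboxm ?_
        rintro ⟨z, s⟩ ⟨_, h2⟩
        have hs : 0 < s := hapos.trans h2.1
        have hs2 : s ≤ 2 * a := h2.2
        apply ENNReal.ofReal_le_ofReal
        simp only []
        gcongr
    _ = volume (coords ⁻¹' box) := by rw [volume_eq_lintegral hsm, himg]
    _ ≤ volume (ball p r) := measure_mono hsub

end H3

open H3

theorem twoCosh_psl_smul (γ : PSL2C) (p q : H3) : twoCosh (γ • p) (γ • q) = twoCosh p q := by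
  obtain ⟨g, rfl⟩ := QuotientGroup.mk_surjective γ
  exact twoCosh_smul g p q

theorem measurable_psl_smul (γ : PSL2C) : Measurable (fun p : H3 => γ • p) := by
  obtain ⟨g, rfl⟩ := QuotientGroup.mk_surjective γ
  exact measurable_smul g

theorem volume_image_psl_smul (γ : PSL2C) {s : Set H3} (hs : MeasurableSet s) :
    volume ((fun p : H3 => γ • p) '' s) = volume s := by
  obtain ⟨g, rfl⟩ := QuotientGroup.mk_surjective γ
  exact volume_image_smul g hs

theorem measurableSet_image_psl_smul (γ : PSL2C) {s : Set H3} (hs : MeasurableSet s) :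
    MeasurableSet ((fun p : H3 => γ • p) '' s) := by
  obtain ⟨g, rfl⟩ := QuotientGroup.mk_surjective γ
  exact measurableSet_image_smul g hs

theorem proj_eq_iff {Γ : Subgroup PSL2C} {p q : H3} :
    proj Γ p = proj Γ q ↔ ∃ γ ∈ Γ, γ • q = p := by
  unfold proj
  rw [Quotient.eq, MulAction.orbitRel_apply]
  constructor
  · rintro ⟨γ, h⟩
    exact ⟨γ.1, γ.2, h⟩
  · rintro ⟨γ, hγ, h⟩
    exact ⟨⟨γ, hγ⟩, h⟩

/-- The action of `Γ` on `ℍ³` is free. -/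
def ActsFreely (Γ : Subgroup PSL2C) : Prop := ∀ γ ∈ Γ, ∀ p : H3, γ • p = p → γ = 1

/-- A set which embeds in the quotient has at most the volume of its image. -/
theorem volume_le_vol_image_proj {Γ : Subgroup PSL2C} [Countable Γ] (hfree : ActsFreely Γ)
    {U : Set H3} (hU : MeasurableSet U) (hinj : Set.InjOn (proj Γ) U) :
    volume U ≤ vol Γ (proj Γ '' U) := by
  refine le_iInf₂ fun D hD => le_iInf fun hUD => ?_
  -- The parts of D that γ carries into U. They are disjoint because U embeds and the action is
  -- free, and their translates cover U.
  let f : Γ → Set H3 := fun γ => (fun p : H3 => (γ : PSL2C) • p) ⁻¹' U ∩ D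
  have hfm : ∀ γ, MeasurableSet (f γ) := fun γ => (measurable_psl_smul γ.1 hU).inter hD
  have hdisj : Pairwise (Function.onFun Disjoint f) := by
    intro γ δ hne
    rw [Function.onFun, Set.disjoint_left]
    rintro x ⟨h1, _⟩ ⟨h2, _⟩
    have h3 : γ.1 • x = δ.1 • x := hinj h1 h2 (proj_eq_iff.mpr
      ⟨γ.1 * δ.1⁻¹, Γ.mul_mem γ.2 (Γ.inv_mem δ.2), by rw [mul_smul, inv_smul_smul]⟩)
    have h4 : δ.1⁻¹ * γ.1 = 1 := hfree _ (Γ.mul_mem (Γ.inv_mem δ.2) γ.2) x (by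
      rw [mul_smul, h3, inv_smul_smul])
    exact hne (Subtype.ext (inv_mul_eq_one.mp h4).symm)
  have hcov : U ⊆ ⋃ γ : Γ, (fun p : H3 => (γ : PSL2C) • p) '' f γ := by
    intro x hx
    obtain ⟨y, hy, hxy⟩ := hUD ⟨x, hx, rfl⟩
    obtain ⟨γ, hγ, rfl⟩ := proj_eq_iff.mp hxy.symm
    exact Set.mem_iUnion.mpr ⟨⟨γ, hγ⟩, y, ⟨hx, hy⟩, rfl⟩
  calc volume U ≤ ∑' γ : Γ, volume ((fun p : H3 => (γ : PSL2C) • p) '' f γ) :=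
        (measure_mono hcov).trans (measure_iUnion_le _)
    _ = ∑' γ : Γ, volume (f γ) := by
        congr 1; ext γ; exact volume_image_psl_smul γ.1 (hfm γ)
    _ = volume (⋃ γ, f γ) := (measure_iUnion hdisj hfm).symm
    _ ≤ volume D := measure_mono (Set.iUnion_subset fun γ => Set.inter_subset_right)

/-- The volume of a finite cover is bounded by the degree times the volume of a set covering the
base. -/
theorem vol_univ_le_relIndex_mul {Γ Γ₀ : Subgroup PSL2C} (hidx : Γ₀.relIndex Γ ≠ 0)
    {D : Set H3} (hD : MeasurableSet D) (hcov : Set.univ ⊆ proj Γ '' D) :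
    vol Γ₀ Set.univ ≤ Γ₀.relIndex Γ * volume D := by
  let Q := Γ ⧸ Γ₀.subgroupOf Γ
  have hfin : Finite Q := Subgroup.index_ne_zero_iff_finite.mp hidx
  have : Fintype Q := Fintype.ofFinite Q
  -- Inverting representatives of the left cosets gives representatives of the cosets Γ₀γ, as needed
  -- for the quotient by Γ₀.
  let E : Set H3 := ⋃ q : Q, (fun p : H3 => ((q.out : Γ) : PSL2C)⁻¹ • p) '' D
  have hE : MeasurableSet E := MeasurableSet.iUnion fun q => measurableSet_image_psl_smul _ hD
  have hEcov : Set.univ ⊆ proj Γ₀ '' E := by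
    intro y _
    obtain ⟨x, rfl⟩ := Quotient.exists_rep y
    obtain ⟨d, hd, hdx⟩ := hcov (Set.mem_univ (proj Γ x))
    obtain ⟨γ, hγ, rfl⟩ := proj_eq_iff.mp hdx.symm
    let q : Q := QuotientGroup.mk (⟨γ, hγ⟩⁻¹ : Γ)
    have hq : (QuotientGroup.mk q.out : Q) = QuotientGroup.mk (⟨γ, hγ⟩⁻¹ : Γ) :=
      QuotientGroup.out_eq' q
    rw [QuotientGroup.eq, Subgroup.mem_subgroupOf] at hq
    refine ⟨_, Set.mem_iUnion.mpr ⟨q, d, hd, rfl⟩, proj_eq_iff.mpr ⟨_, hq, ?_⟩⟩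
    simp [mul_smul]
  refine (iInf₂_le_of_le E hE (iInf_le _ hEcov)).trans ?_
  calc volume E ≤ ∑' q : Q, volume ((fun p : H3 => ((q.out : Γ) : PSL2C)⁻¹ • p) '' D) :=
        measure_iUnion_le _
    _ = ∑' _ : Q, volume D := by
        congr 1; ext q; exact volume_image_psl_smul _ hD
    _ = Γ₀.relIndex Γ * volume D := by
        rw [tsum_fintype, Finset.sum_const, nsmul_eq_mul, Finset.card_univ, Subgroup.relIndex,
          Subgroup.index, Nat.card_eq_fintype_card]

/-- The radius satisfies 2 cosh r = √X. Two points of the ball identified by γ would give γ a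
displacement below (2 cosh r)² = X at the centre. The condition X ≥ 32 is cosh² r ≥ 8. -/
theorem exists_embeddedBall {Γ : Subgroup PSL2C} [Countable Γ] (hfree : ActsFreely Γ) (p : H3)
    {X : ℝ} (hX : 32 ≤ X) (hdisp : ∀ γ ∈ Γ, γ ≠ 1 → X ≤ twoCosh (γ • p) p) :
    ∃ B, IsEmbeddedBall Γ B ∧ ENNReal.ofReal (Real.pi / 64 * X) ≤ vol Γ B := by
  have hs : 1 < √X / 2 := by
    rw [lt_div_iff₀ (by norm_num), one_mul]
    exact Real.lt_sqrt_of_sq_lt (by linarith)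
  set r := Real.arcosh (√X / 2) with hrdef
  have hr : 0 < r := Real.arcosh_pos hs
  have hc : Real.cosh r = √X / 2 := Real.cosh_arcosh hs.le
  have hc2 : Real.cosh r ^ 2 = X / 4 := by
    rw [hc, div_pow, Real.sq_sqrt (by linarith)]; norm_num
  have hinj : Set.InjOn (proj Γ) (ball p r) := by
    intro x hx y hy hxy
    obtain ⟨γ, hγ, rfl⟩ := proj_eq_iff.mp hxy
    by_contra hne
    have hγ1 : γ ≠ 1 := by rintro rfl; exact hne (one_smul _ _)
    rw [ball_eq hr, Set.mem_ofPred_eq] at hx hy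
    have h1 := hdisp γ hγ hγ1
    have h2 := twoCosh_mul_le (γ • p) (γ • y) p
    rw [twoCosh_psl_smul, twoCosh_comm (γ • y) p] at h2
    have h3 := twoCosh_pos p y
    have h4 := twoCosh_pos p (γ • y)
    nlinarith
  refine ⟨_, ⟨p, r, hr, hinj, rfl⟩, ?_⟩
  refine le_trans ?_ ((volume_ball_ge p hr (by rw [hc2]; linarith)).trans
    (volume_le_vol_image_proj hfree (measurableSet_ball p hr) hinj))
  rw [hc2]
  exact ENNReal.ofReal_le_ofReal (le_of_eq (by ring))

theorem vol_mono (Γ : Subgroup PSL2C) {A B : Set (HypQuot Γ)} (h : A ⊆ B) : vol Γ A ≤ vol Γ B :=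
  le_iInf₂ fun D hD => le_iInf fun hBD => iInf₂_le_of_le D hD (iInf_le _ (h.trans hBD))

end HypThree

/-! ### Lower bounds for the displacement from the arithmetic of matrix entries. -/

namespace HypThree

open H3

theorem twoCosh_toPSL2C_smul_axis {K : Type*} [Field K] (φ : K →+* ℂ) (g : SL(2, 𝓞 K)) {t : ℝ}
    (ht : 0 < t) :
    twoCosh (toPSL2C φ g • axis t ht) (axis t ht) =
      Complex.normSq (φ (g 0 0)) + Complex.normSq (φ (g 1 1)) + Complex.normSq (φ (g 0 1)) / t ^ 2 +
        Complex.normSq (φ (g 1 0)) * t ^ 2 :=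
  twoCosh_smul_axis _ ht

theorem countable_bianchi {K : Type*} [Field K] [NumberField K] (φ : K →+* ℂ) :
    Countable (bianchi φ) := by
  have : Countable (𝓞 K) := (NumberField.RingOfIntegers.basis K).equivFun.injective.countable
  have h : Countable (SL(2, 𝓞 K)) :=
    Function.Injective.countable (f := fun g : SL(2, 𝓞 K) => (fun i j => g i j : Fin 2 → Fin 2 → 𝓞 K))
      (fun g h e => Subtype.ext e)
  exact (toPSL2C φ).rangeRestrict_surjective.countable

section ImaginaryQuadratic

variable {K : Type*} [Field K] [NumberField K] [NumberField.IsTotallyComplex K]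

theorem infinitePlace_eq (hK : Module.finrank ℚ K = 2) (v w : NumberField.InfinitePlace K) :
    v = w := by
  have h1 := NumberField.IsTotallyComplex.finrank K
  have h2 := NumberField.InfinitePlace.card_eq_nrRealPlaces_add_nrComplexPlaces K
  rw [NumberField.IsTotallyComplex.nrRealPlaces_eq_zero] at h2
  have : Fintype.card (NumberField.InfinitePlace K) ≤ 1 := by omega
  exact Fintype.card_le_one_iff.mp this v w

/-- There is only one infinite place, with multiplicity 2, so the product over places that computes
the field norm has the single factor |φ x|². -/
theorem normSq_embedding (hK : Module.finrank ℚ K = 2) (φ : K →+* ℂ) (x : 𝓞 K) :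
    Complex.normSq (φ x) = Ideal.absNorm (Ideal.span {x}) := by
  have h := NumberField.InfinitePlace.prod_eq_abs_norm (x : K)
  have hs : (Finset.univ : Finset (NumberField.InfinitePlace K)) =
      {NumberField.InfinitePlace.mk φ} := by
    ext w; simp [infinitePlace_eq hK w (NumberField.InfinitePlace.mk φ)]
  rw [hs, Finset.prod_singleton, NumberField.IsTotallyComplex.mult_eq,
    NumberField.InfinitePlace.apply, ← Complex.normSq_eq_norm_sq, ← Algebra.coe_norm_int] at h
  rw [h, Ideal.absNorm_span_singleton, Nat.cast_natAbs]
  push_cast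
  rfl

/-- The inclusion (x) ⊆ I makes the norm of I divide the norm of (x), which is nonzero. -/
theorem absNorm_le_normSq (hK : Module.finrank ℚ K = 2) (φ : K →+* ℂ) {I : Ideal (𝓞 K)} {x : 𝓞 K}
    (hx : x ∈ I) (h0 : x ≠ 0) : (Ideal.absNorm I : ℝ) ≤ Complex.normSq (φ x) := by
  rw [normSq_embedding hK]
  have h1 := Ideal.absNorm_dvd_absNorm_of_le ((Ideal.span_singleton_le_iff_mem I).mpr hx)
  have h2 : Ideal.absNorm (Ideal.span {x}) ≠ 0 := by
    simpa [Ideal.absNorm_eq_zero_iff] using h0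
  exact_mod_cast Nat.le_of_dvd (Nat.pos_of_ne_zero h2) h1

theorem one_le_normSq (hK : Module.finrank ℚ K = 2) (φ : K →+* ℂ) {x : 𝓞 K} (h0 : x ≠ 0) :
    1 ≤ Complex.normSq (φ x) := by
  simpa using absNorm_le_normSq hK φ (I := ⊤) (x := x) trivial h0

/-- All complex embeddings give x the same absolute value, so this is the finiteness of algebraic
integers with bounded conjugates. -/
theorem finite_normSq_le (hK : Module.finrank ℚ K = 2) (φ : K →+* ℂ) (B : ℝ) :
    {x : 𝓞 K | Complex.normSq (φ x) ≤ B}.Finite := by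
  refine ((NumberField.Embeddings.finite_of_norm_le K ℂ √B).preimage
    (NumberField.RingOfIntegers.coe_injective.injOn)).subset fun x hx => ?_
  refine ⟨x.isIntegral_coe, fun ψ => ?_⟩
  have h := normSq_embedding hK ψ x
  rw [← normSq_embedding hK φ, Complex.normSq_eq_norm_sq] at h
  exact Real.le_sqrt_of_sq_le (h.trans_le hx)

/-- An element fixing p moves the base point `o` by at most a bounded amount, which bounds all its
matrix entries. -/
theorem finite_stabilizer (hK : Module.finrank ℚ K = 2) (φ : K →+* ℂ) (p : H3) :
    {γ : PSL2C | γ ∈ bianchi φ ∧ γ • p = p}.Finite := by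
  let o := axis 1 one_pos
  let B := twoCosh p o ^ 2
  have hB : {g : SL(2, 𝓞 K) | toPSL2C φ g • p = p}.Finite := by
    refine ((Set.Finite.pi fun _ : Fin 2 => Set.Finite.pi fun _ : Fin 2 =>
      finite_normSq_le hK φ B).preimage (f := fun g : SL(2, 𝓞 K) =>
        (fun i j => g i j : Fin 2 → Fin 2 → 𝓞 K)) (fun g _ h _ e => Subtype.ext e)).subset ?_
    intro g hg
    have hg' : toPSL2C φ g • p = p := hg
    have h1 := twoCosh_mul_le (toPSL2C φ g • o) (toPSL2C φ g • p) o
    rw [twoCosh_psl_smul, hg', twoCosh_comm o p, ← sq, twoCosh_toPSL2C_smul_axis] at h1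
    simp only [one_pow, div_one, mul_one] at h1
    have n1 := Complex.normSq_nonneg (φ (g 0 0))
    have n2 := Complex.normSq_nonneg (φ (g 0 1))
    have n3 := Complex.normSq_nonneg (φ (g 1 0))
    have n4 := Complex.normSq_nonneg (φ (g 1 1))
    intro i _ j _
    change Complex.normSq (φ (g i j)) ≤ twoCosh p o ^ 2
    fin_cases i <;> fin_cases j <;> simp only [Fin.zero_eta, Fin.mk_one] <;> linarith
  refine (hB.image (toPSL2C φ)).subset ?_
  rintro _ ⟨⟨g, rfl⟩, hg⟩
  exact ⟨g, hg, rfl⟩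

/-- The powers of an element fixing p stay in the finite stabilizer, so the element has finite
order. -/
theorem actsFreely_of_isTorsionFree (hK : Module.finrank ℚ K = 2) (φ : K →+* ℂ)
    {Γ : Subgroup PSL2C} (hΓ : Γ ≤ bianchi φ) (htf : IsTorsionFree Γ) : ActsFreely Γ := by
  intro γ hγ p hp
  refine htf γ hγ (finite_powers.mp ((finite_stabilizer hK φ p).subset ?_))
  rintro _ ⟨n, rfl⟩
  refine ⟨hΓ (Γ.pow_mem hγ n), ?_⟩
  have : γ ∈ MulAction.stabilizer PSL2C p := hp
  exact (MulAction.stabilizer PSL2C p).pow_mem this n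

/-- A nontrivial element of a torsion-free group is not represented by a diagonal matrix. -/
theorem exists_offDiag_ne_zero (hK : Module.finrank ℚ K = 2) (φ : K →+* ℂ) {Γ : Subgroup PSL2C}
    (hfree : ActsFreely Γ) {g : SL(2, 𝓞 K)} (hg : toPSL2C φ g ∈ Γ) (h1 : toPSL2C φ g ≠ 1) :
    g 0 1 ≠ 0 ∨ g 1 0 ≠ 0 := by
  by_contra! h
  obtain ⟨hb, hc⟩ := h
  have hdet : g 0 0 * g 1 1 = 1 := by
    have := g.det_coe
    rwa [Matrix.det_fin_two, hb, hc, mul_zero, sub_zero] at this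
  have ha := one_le_normSq hK φ (left_ne_zero_of_mul_eq_one hdet)
  have hd := one_le_normSq hK φ (right_ne_zero_of_mul_eq_one hdet)
  have had : Complex.normSq (φ (g 0 0)) * Complex.normSq (φ (g 1 1)) = 1 := by
    rw [← map_mul, ← map_mul, ← map_mul, hdet, map_one, map_one, map_one]
  -- Both |a|² and |d|² are at least 1 and their product is 1, so the displacement of the point j
  -- takes its minimal value 2 and j is fixed.
  refine h1 (hfree _ hg (axis 1 one_pos) (eq_of_twoCosh_le_two ?_))
  rw [twoCosh_toPSL2C_smul_axis, hb, hc]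
  simp only [map_zero, zero_div, zero_mul, add_zero]
  nlinarith

/-- If b ≠ 0 its term is at least 1/t²; otherwise c is a nonzero element of I and its term is at
least N(I)t². -/
theorem le_twoCosh_of_mem_hecke0 (hK : Module.finrank ℚ K = 2) (φ : K →+* ℂ) {Γ : Subgroup PSL2C}
    (hfree : ActsFreely Γ) {I : Ideal (𝓞 K)} {t X : ℝ} (ht : 0 < t)
    (hX1 : X ≤ Ideal.absNorm I * t ^ 2) (hX2 : X * t ^ 2 ≤ 1) {γ : PSL2C} (hγ : γ ∈ Gamma0 φ Γ I)
    (h1 : γ ≠ 1) : X ≤ twoCosh (γ • axis t ht) (axis t ht) := by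
  obtain ⟨hγΓ, g, hg, rfl⟩ := hγ
  have hgI : g 1 0 ∈ I := Ideal.Quotient.eq_zero_iff_mem.mp hg
  rw [twoCosh_toPSL2C_smul_axis]
  have n1 := Complex.normSq_nonneg (φ (g 0 0))
  have n2 := Complex.normSq_nonneg (φ (g 0 1))
  have n3 := Complex.normSq_nonneg (φ (g 1 0))
  have n4 := Complex.normSq_nonneg (φ (g 1 1))
  have n5 : 0 ≤ Complex.normSq (φ (g 0 1)) / t ^ 2 := by positivity
  have n6 : 0 ≤ Complex.normSq (φ (g 1 0)) * t ^ 2 := by positivity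
  rcases exists_offDiag_ne_zero hK φ hfree hγΓ h1 with h | h
  · have h2 : X ≤ Complex.normSq (φ (g 0 1)) / t ^ 2 := by
      rw [le_div_iff₀ (by positivity)]
      exact hX2.trans (one_le_normSq hK φ h)
    linarith
  · have h2 : X ≤ Complex.normSq (φ (g 1 0)) * t ^ 2 :=
      hX1.trans (mul_le_mul_of_nonneg_right (absNorm_le_normSq hK φ hgI h) (by positivity))
    linarith

theorem absNorm_le_twoCosh_of_mem_principal (hK : Module.finrank ℚ K = 2) (φ : K →+* ℂ)
    {Γ : Subgroup PSL2C} (hfree : ActsFreely Γ) {I : Ideal (𝓞 K)} {γ : PSL2C}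
    (hγ : γ ∈ GammaP φ Γ I) (h1 : γ ≠ 1) :
    (Ideal.absNorm I : ℝ) ≤ twoCosh (γ • axis 1 one_pos) (axis 1 one_pos) := by
  obtain ⟨hγΓ, g, hg, rfl⟩ := hγ
  have hoff : ∀ i j, i ≠ j → g i j ∈ I := by
    intro i j hij
    apply Ideal.Quotient.eq_zero_iff_mem.mp
    change red I g i j = 0
    rcases hg with hg | hg <;> rw [hg] <;> simp [hij]
  rw [twoCosh_toPSL2C_smul_axis]
  have n1 := Complex.normSq_nonneg (φ (g 0 0))
  have n2 := Complex.normSq_nonneg (φ (g 0 1))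
  have n3 := Complex.normSq_nonneg (φ (g 1 0))
  have n4 := Complex.normSq_nonneg (φ (g 1 1))
  simp only [one_pow, div_one, mul_one]
  rcases exists_offDiag_ne_zero hK φ hfree hγΓ h1 with h | h
  · linarith [absNorm_le_normSq hK φ (hoff 0 1 (by decide)) h]
  · linarith [absNorm_le_normSq hK φ (hoff 1 0 (by decide)) h]

end ImaginaryQuadratic

end HypThree

/-! ### Upper bounds for the indices of the congruence subgroups. -/

namespace HypThree

theorem index_le_card_of_separates {G X : Type*} [Group G] [Finite X] (H : Subgroup G) (f : G → X)
    (hf : ∀ g h, f g = f h → g⁻¹ * h ∈ H) : H.index ≠ 0 ∧ H.index ≤ Nat.card X := by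
  have hinj : Function.Injective (fun q : G ⧸ H => f q.out) := fun q q' h => by
    rw [← QuotientGroup.out_eq' q, ← QuotientGroup.out_eq' q', QuotientGroup.eq]
    exact hf _ _ h
  have : Finite (G ⧸ H) := Finite.of_injective _ hinj
  exact ⟨Subgroup.index_ne_zero_of_finite, Nat.card_le_card_of_injective _ hinj⟩

section Index

variable {K : Type*} [Field K]

/-- The index in `Γ` of the part of `Γ` that lies in the image of `H`. -/
theorem relIndex_inf_map_le (φ : K →+* ℂ) {Γ : Subgroup PSL2C} (hΓ : Γ ≤ bianchi φ)
    {H : Subgroup SL(2, 𝓞 K)} (hH : H.index ≠ 0) :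
    (Γ ⊓ H.map (toPSL2C φ)).relIndex Γ ≤ H.index := by
  have h1 : (H.map (toPSL2C φ)).relIndex (bianchi φ) ∣ H.index := by
    rw [bianchi, MonoidHom.range_eq_map, Subgroup.relIndex_map_map, top_sup_eq,
      Subgroup.relIndex_top_right]
    exact Subgroup.index_dvd_of_le le_sup_left
  have h2 : (H.map (toPSL2C φ)).relIndex (bianchi φ) ≠ 0 := ne_zero_of_dvd_ne_zero hH h1
  rw [Subgroup.inf_relIndex_left]
  exact (Subgroup.relIndex_le_of_le_right hΓ h2).trans (Nat.le_of_dvd (Nat.pos_of_ne_zero hH) h1)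

theorem inv_mul_apply_one_zero {R : Type*} [CommRing R] (g h : SL(2, R)) :
    (g⁻¹ * h) 1 0 = g 0 0 * h 1 0 - g 1 0 * h 0 0 := by
  rw [Matrix.SpecialLinearGroup.coe_mul, Matrix.SpecialLinearGroup.coe_inv,
    Matrix.adjugate_fin_two]
  simp [Matrix.mul_apply, Fin.sum_univ_two]
  ring

theorem inv_mul_apply_zero_zero {R : Type*} [CommRing R] (g h : SL(2, R)) :
    (g⁻¹ * h) 0 0 = g 1 1 * h 0 0 - g 0 1 * h 1 0 := by
  rw [Matrix.SpecialLinearGroup.coe_mul, Matrix.SpecialLinearGroup.coe_inv,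
    Matrix.adjugate_fin_two]
  simp [Matrix.mul_apply, Fin.sum_univ_two]
  ring

/-- Matrices with the same first column differ by an upper unipotent matrix. -/
theorem inv_mul_unipotent {R : Type*} [CommRing R] {g h : SL(2, R)} (h0 : g 0 0 = h 0 0)
    (h1 : g 1 0 = h 1 0) :
    (g⁻¹ * h) 1 0 = 0 ∧ (g⁻¹ * h) 0 0 = 1 ∧ (g⁻¹ * h) 1 1 = 1 := by
  have hg := g.det_coe
  rw [Matrix.det_fin_two] at hg
  have e1 : (g⁻¹ * h) 1 0 = 0 := by rw [inv_mul_apply_one_zero, h0, h1]; ring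
  have e2 : (g⁻¹ * h) 0 0 = 1 := by
    rw [inv_mul_apply_zero_zero, ← h0, ← h1]; linear_combination hg
  have e3 := (g⁻¹ * h).det_coe
  rw [Matrix.det_fin_two, e1, e2] at e3
  exact ⟨e1, e2, by linear_combination e3⟩

/-- The order of `SL₂(R)` is at most `|R|³`. -/
theorem card_SL2_le (R : Type*) [CommRing R] [Finite R] :
    Nat.card SL(2, R) ≤ Nat.card R ^ 3 := by
  classical
  let col : SL(2, R) → R × R := fun g => (g 0 0, g 1 0)
  -- One matrix is chosen for each first column that occurs; every other matrix with that column
  -- differs from it by an upper unipotent factor, hence by one element of R.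
  let s : SL(2, R) → SL(2, R) := fun g => Function.surjInv (f := Set.rangeFactorization col)
    Set.rangeFactorization_surjective ⟨col g, g, rfl⟩
  have hs : ∀ g, col (s g) = col g := fun g => congrArg Subtype.val
    (Function.surjInv_eq (f := Set.rangeFactorization col)
      Set.rangeFactorization_surjective ⟨col g, g, rfl⟩)
  have hs' : ∀ g h, col g = col h → s g = s h := fun g h e => by simp only [s, e]
  let f : SL(2, R) → (R × R) × R := fun g => (col g, ((s g)⁻¹ * g) 0 1)
  have hf : Function.Injective f := by
    intro g h e
    have e1 : col g = col h := congrArg Prod.fst e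
    have e2 : ((s g)⁻¹ * g) 0 1 = ((s h)⁻¹ * h) 0 1 := congrArg Prod.snd e
    have u : ∀ g, ((s g)⁻¹ * g) 1 0 = 0 ∧ ((s g)⁻¹ * g) 0 0 = 1 ∧ ((s g)⁻¹ * g) 1 1 = 1 :=
      fun g => inv_mul_unipotent (congrArg Prod.fst (hs g)) (congrArg Prod.snd (hs g))
    have : (s g)⁻¹ * g = (s h)⁻¹ * h := by
      obtain ⟨a1, a2, a3⟩ := u g
      obtain ⟨b1, b2, b3⟩ := u h
      apply Matrix.SpecialLinearGroup.ext
      intro i j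
      fin_cases i <;> fin_cases j
      · exact a2.trans b2.symm
      · exact e2
      · exact a1.trans b1.symm
      · exact a3.trans b3.symm
    rw [hs' g h e1] at this
    exact mul_left_cancel this
  refine (Nat.card_le_card_of_injective f hf).trans (le_of_eq ?_)
  rw [Nat.card_prod, Nat.card_prod]
  ring

theorem hecke0_inf_le_of_isCoprime {I J : Ideal (𝓞 K)} (hIJ : IsCoprime I J) :
    hecke0 I ⊓ hecke0 J ≤ hecke0 (I * J) := by
  rintro g ⟨h1, h2⟩
  have h1' : g 1 0 ∈ I := Ideal.Quotient.eq_zero_iff_mem.mp h1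
  have h2' : g 1 0 ∈ J := Ideal.Quotient.eq_zero_iff_mem.mp h2
  exact Ideal.Quotient.eq_zero_iff_mem.mpr
    (Ideal.mul_eq_inf_of_isCoprime hIJ ▸ Submodule.mem_inf.mpr ⟨h1', h2'⟩)

variable [NumberField K]

theorem card_quotient_ideal (I : Ideal (𝓞 K)) : Nat.card (𝓞 K ⧸ I) = Ideal.absNorm I := by
  rw [Ideal.absNorm_apply, Submodule.cardQuot_apply]

theorem finite_quotient {I : Ideal (𝓞 K)} (hI : I ≠ ⊥) : Finite (𝓞 K ⧸ I) := by
  apply Nat.finite_of_card_ne_zero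
  rw [card_quotient_ideal]
  exact fun h => hI (Ideal.absNorm_eq_zero_iff.mp h)

/-- The first column modulo I determines the coset, and there are N(I)² possible columns. -/
theorem index_hecke1 {I : Ideal (𝓞 K)} (hI : I ≠ ⊥) :
    (hecke1 I).index ≠ 0 ∧ (hecke1 I).index ≤ Ideal.absNorm I ^ 2 := by
  have := finite_quotient hI
  have h := index_le_card_of_separates (hecke1 I)
    (fun g => ((red I g 0 0, red I g 1 0) : (𝓞 K ⧸ I) × (𝓞 K ⧸ I))) (by
      intro g h e
      obtain ⟨a1, a2, a3⟩ := inv_mul_unipotent (g := red I g) (h := red I h)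
        (congrArg Prod.fst e) (congrArg Prod.snd e)
      rw [← map_inv, ← map_mul] at a1 a2 a3
      exact ⟨a1, Or.inl ⟨a2, a3⟩⟩)
  rwa [Nat.card_prod, card_quotient_ideal, ← sq] at h

theorem index_principal {I : Ideal (𝓞 K)} (hI : I ≠ ⊥) :
    (principal I).index ≠ 0 ∧ (principal I).index ≤ Ideal.absNorm I ^ 3 := by
  have := finite_quotient hI
  have : Finite SL(2, 𝓞 K ⧸ I) := Subtype.finite
  have h := index_le_card_of_separates (principal I) (red I) (by
    intro g h e
    left
    rw [map_mul, map_inv, e, inv_mul_cancel])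
  exact ⟨h.1, h.2.trans ((card_SL2_le _).trans (by rw [card_quotient_ideal]))⟩

/-- Cosets are separated by the point [a : c] of the projective line over the residue field; `none`
is the point with a = 0. -/
theorem index_hecke0_of_prime {P : Ideal (𝓞 K)} (hP : P.IsPrime) (h0 : P ≠ ⊥) :
    (hecke0 P).index ≠ 0 ∧ (hecke0 P).index ≤ Ideal.absNorm P + 1 := by
  classical
  have := finite_quotient h0
  have : P.IsMaximal := hP.isMaximal h0
  let _ : Field (𝓞 K ⧸ P) := Ideal.Quotient.field P
  have h := index_le_card_of_separates (hecke0 P)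
    (fun g => if red P g 0 0 = 0 then none else some (red P g 1 0 / red P g 0 0)) (by
      intro g h e
      change red P (g⁻¹ * h) 1 0 = 0
      rw [map_mul, map_inv, inv_mul_apply_one_zero]
      by_cases hg : red P g 0 0 = 0 <;> by_cases hh : red P h 0 0 = 0
      · rw [hg, hh]; ring
      · simp [hg, hh] at e
      · simp [hg, hh] at e
      · simp only [hg, hh, if_false, Option.some.injEq] at e
        rw [div_eq_div_iff hg hh] at e
        linear_combination -e)
  rwa [Finite.card_option, card_quotient_ideal] at h

/-- Distinct primes are coprime, so the subgroup for a product contains the intersection of those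
for the factors, and the index of an intersection is at most the product of the indices. -/
theorem index_hecke0_prod (s : Finset (Ideal (𝓞 K))) (hs : ∀ P ∈ s, P.IsPrime ∧ P ≠ ⊥) :
    (hecke0 (∏ P ∈ s, P)).index ≠ 0 ∧
      (hecke0 (∏ P ∈ s, P)).index ≤ ∏ P ∈ s, (Ideal.absNorm P + 1) := by
  classical
  induction s using Finset.induction_on with
  | empty =>
    have : hecke0 (1 : Ideal (𝓞 K)) = ⊤ := by
      rw [eq_top_iff]
      intro g _
      exact Ideal.Quotient.eq_zero_iff_mem.mpr (by rw [Ideal.one_eq_top]; trivial)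
    rw [Finset.prod_empty, Finset.prod_empty, this, Subgroup.index_top]
    exact ⟨one_ne_zero, le_rfl⟩
  | insert P s hPs ih =>
    obtain ⟨hP, hs⟩ := Finset.forall_mem_insert _ _ _ |>.mp hs
    obtain ⟨i1, i2⟩ := ih hs
    obtain ⟨j1, j2⟩ := index_hecke0_of_prime hP.1 hP.2
    rw [Finset.prod_insert hPs, Finset.prod_insert hPs]
    have hcop : IsCoprime P (∏ Q ∈ s, Q) := by
      refine IsCoprime.prod_right fun Q hQ => ?_
      have hm := hP.1.isMaximal hP.2
      have hm' := (hs Q hQ).1.isMaximal (hs Q hQ).2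
      exact Ideal.isCoprime_iff_sup_eq.mpr
        (hm.coprime_of_ne hm' (fun h => hPs (h ▸ hQ)))
    have hle := hecke0_inf_le_of_isCoprime hcop
    have hne : (hecke0 P ⊓ hecke0 (∏ Q ∈ s, Q)).index ≠ 0 := Subgroup.index_inf_ne_zero j1 i1
    have hdvd := Subgroup.index_dvd_of_le hle
    exact ⟨ne_zero_of_dvd_ne_zero hne hdvd, (Nat.le_of_dvd (Nat.pos_of_ne_zero hne) hdvd).trans
      (Subgroup.index_inf_le.trans (Nat.mul_le_mul j2 i2))⟩

/-- `∏ (1 + N P) ≤ C N(I) ^ (1 + η)` for square-free `I`. -/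
theorem exists_prod_le (η : ℝ) (hη : 0 < η) : ∃ C : ℝ, 0 < C ∧ ∀ s : Finset (Ideal (𝓞 K)),
    (∀ P ∈ s, P ≠ ⊥) → ∏ P ∈ s, ((Ideal.absNorm P : ℝ) + 1) ≤
      C * ∏ P ∈ s, (Ideal.absNorm P : ℝ) ^ (1 + η) := by
  classical
  -- Once N(P) > 2^(1/η), already 1 + N(P) ≤ 2N(P) ≤ N(P)^(1+η). Each of the finitely many smaller
  -- ideals costs at most a factor 2.
  obtain ⟨n, hn⟩ := exists_nat_gt ((2 : ℝ) ^ (1 / η))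
  have hfin := Ideal.finite_setOfPred_absNorm_le (S := 𝓞 K) n
  set T := hfin.toFinset
  refine ⟨2 ^ T.card, by positivity, fun s hs => ?_⟩
  have h1 : ∀ P ∈ s, (Ideal.absNorm P : ℝ) + 1 ≤
      (if P ∈ T then 2 else 1) * (Ideal.absNorm P : ℝ) ^ (1 + η) := by
    intro P hP
    have hN : (1 : ℝ) ≤ Ideal.absNorm P := by
      exact_mod_cast Nat.one_le_iff_ne_zero.mpr fun h => hs P hP (Ideal.absNorm_eq_zero_iff.mp h)
    rw [Real.rpow_add (by linarith), Real.rpow_one]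
    split_ifs with hT
    · have := Real.one_le_rpow hN hη.le
      nlinarith
    · have hlt : (n : ℝ) < Ideal.absNorm P := by
        have : ¬ Ideal.absNorm P ≤ n := fun h => hT (hfin.mem_toFinset.mpr h)
        exact_mod_cast not_le.mp this
      have : (2 : ℝ) ≤ (Ideal.absNorm P : ℝ) ^ η := by
        calc (2 : ℝ) = ((2 : ℝ) ^ (1 / η)) ^ η := by
              rw [← Real.rpow_mul (by norm_num), one_div_mul_cancel hη.ne', Real.rpow_one]
          _ ≤ _ := Real.rpow_le_rpow (by positivity) (hn.trans hlt).le hη.le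
      nlinarith
  calc ∏ P ∈ s, ((Ideal.absNorm P : ℝ) + 1)
      ≤ ∏ P ∈ s, ((if P ∈ T then 2 else 1) * (Ideal.absNorm P : ℝ) ^ (1 + η)) :=
        Finset.prod_le_prod (fun P _ => by positivity) h1
    _ = (∏ P ∈ s, if P ∈ T then (2 : ℝ) else 1) * ∏ P ∈ s, (Ideal.absNorm P : ℝ) ^ (1 + η) :=
        Finset.prod_mul_distrib
    _ ≤ 2 ^ T.card * ∏ P ∈ s, (Ideal.absNorm P : ℝ) ^ (1 + η) := by
        refine mul_le_mul_of_nonneg_right ?_ (Finset.prod_nonneg fun P _ => by positivity)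
        rw [← Finset.prod_filter, Finset.prod_const]
        refine pow_le_pow_right₀ (by norm_num) (Finset.card_le_card fun P hP => ?_)
        exact (Finset.mem_filter.mp hP).2

theorem index_hecke0_ne_zero_and_le (η : ℝ) (hη : 0 < η) : ∃ C : ℝ, 0 < C ∧
    ∀ I : Ideal (𝓞 K), Squarefree I → (hecke0 I).index ≠ 0 ∧
      ((hecke0 I).index : ℝ) ≤ C * (Ideal.absNorm I : ℝ) ^ (1 + η) := by
  classical
  obtain ⟨C, hC, h⟩ := exists_prod_le (K := K) η hη
  refine ⟨C, hC, fun I hI => ?_⟩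
  set s := (UniqueFactorizationMonoid.normalizedFactors I).toFinset with hs
  -- Square-freeness makes I the product of its distinct prime factors.
  have hprod : ∏ P ∈ s, P = I := by
    have hnd := (UniqueFactorizationMonoid.squarefree_iff_nodup_normalizedFactors hI.ne_zero).mp hI
    rw [Finset.prod, hs, Multiset.toFinset_val, Multiset.dedup_eq_self.mpr hnd, Multiset.map_id',
      Ideal.prod_normalizedFactors_eq_self hI.ne_zero]
  have hprime : ∀ P ∈ s, P.IsPrime ∧ P ≠ ⊥ := by
    intro P hP
    have := UniqueFactorizationMonoid.prime_of_normalized_factor P (Multiset.mem_toFinset.mp hP)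
    exact ⟨Ideal.isPrime_of_prime this, this.ne_zero⟩
  obtain ⟨i1, i2⟩ := index_hecke0_prod s hprime
  have hN : (Ideal.absNorm I : ℝ) ^ (1 + η) = ∏ P ∈ s, (Ideal.absNorm P : ℝ) ^ (1 + η) := by
    rw [Real.finsetProd_rpow _ _ (fun P _ => by positivity), ← Nat.cast_prod, ← map_prod, hprod]
  rw [hprod] at i1 i2
  refine ⟨i1, ?_⟩
  rw [hN]
  refine le_trans ?_ (h s fun P hP => (hprime P hP).2)
  exact_mod_cast i2

end Index

end HypThree

/-! ### Comparison of the ball with the cover, and the three cases. -/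

namespace HypThree

open H3

theorem exists_measurable_cover_of_vol_ne_top {Γ : Subgroup PSL2C} (h : vol Γ Set.univ ≠ ⊤) :
    ∃ D : Set H3, MeasurableSet D ∧ Set.univ ⊆ proj Γ '' D ∧ volume D ≠ ⊤ := by
  obtain ⟨D, hD⟩ := iInf_lt_iff.mp h.lt_top
  obtain ⟨hDm, hD⟩ := iInf_lt_iff.mp hD
  obtain ⟨hDc, hD⟩ := iInf_lt_iff.mp hD
  exact ⟨D, hDm, hDc, hD.ne⟩

/-- A finite cover whose deck elements move some point far away contains an embedded ball whose
volume is large compared with the volume of the cover. -/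
theorem exists_embeddedBall_of_cover {Γ Γ₀ : Subgroup PSL2C} [Countable Γ₀] (hle : Γ₀ ≤ Γ)
    (hfree : ActsFreely Γ) (hidx : Γ₀.relIndex Γ ≠ 0) {D : Set H3} (hD : MeasurableSet D)
    (hcov : Set.univ ⊆ proj Γ '' D) (hfin : volume D ≠ ⊤) (p : H3) {X W c e : ℝ} (hX : 32 ≤ X)
    (hdisp : ∀ γ ∈ Γ₀, γ ≠ 1 → X ≤ twoCosh (γ • p) p)
    (hW : Γ₀.relIndex Γ * (volume D).toReal ≤ W) (hc : 0 ≤ c) (he : 0 ≤ e)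
    (hlt : c * W ^ e < Real.pi / 64 * X) :
    1 ≤ vol Γ₀ Set.univ ∧ ∃ B, IsEmbeddedBall Γ₀ B ∧
      ENNReal.ofReal c * vol Γ₀ Set.univ ^ e < vol Γ₀ B := by
  obtain ⟨B, hB, hBvol⟩ := exists_embeddedBall (fun γ hγ => hfree γ (hle hγ)) p hX hdisp
  have hW0 : 0 ≤ W := le_trans (by positivity) hW
  have hV : vol Γ₀ Set.univ ≤ ENNReal.ofReal W := by
    refine (vol_univ_le_relIndex_mul hidx hD hcov).trans ?_
    rw [← ENNReal.ofReal_toReal hfin, ← ENNReal.ofReal_natCast, ← ENNReal.ofReal_mul (by positivity)]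
    exact ENNReal.ofReal_le_ofReal hW
  refine ⟨?_, B, hB, lt_of_lt_of_le ?_ hBvol⟩
  -- The ball alone has volume at least 32π/64 > 1.
  · refine le_trans ?_ (hBvol.trans (vol_mono Γ₀ (Set.subset_univ B)))
    rw [ENNReal.one_le_ofReal]
    nlinarith [Real.pi_gt_three]
  · calc ENNReal.ofReal c * vol Γ₀ Set.univ ^ e
        ≤ ENNReal.ofReal c * ENNReal.ofReal W ^ e := by gcongr
      _ = ENNReal.ofReal (c * W ^ e) := by
          rw [ENNReal.ofReal_rpow_of_nonneg hW0 he, ENNReal.ofReal_mul hc]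
      _ < _ := (ENNReal.ofReal_lt_ofReal_iff (by positivity)).mpr hlt

theorem hecke1_le_hecke0 {K : Type*} [Field K] (I : Ideal (𝓞 K)) : hecke1 I ≤ hecke0 I :=
  fun _ h => h.1

theorem countable_of_le_bianchi {K : Type*} [Field K] [NumberField K] {φ : K →+* ℂ}
    {Γ : Subgroup PSL2C} (h : Γ ≤ bianchi φ) : Countable Γ :=
  have := countable_bianchi φ
  (Subgroup.inclusion_injective h).countable

/-- A point on the axis which is moved far away by all of `Γ₀(I)`. -/
theorem exists_axis_sqrt_le_twoCosh {K : Type*} [Field K] [NumberField K]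
    [NumberField.IsTotallyComplex K] (hK : Module.finrank ℚ K = 2) (φ : K →+* ℂ)
    {Γ : Subgroup PSL2C} (hfree : ActsFreely Γ) {I : Ideal (𝓞 K)} (hI : I ≠ ⊥) :
    ∃ p : H3, ∀ γ ∈ Gamma0 φ Γ I, γ ≠ 1 → √(Ideal.absNorm I) ≤ twoCosh (γ • p) p := by
  have hN : (0 : ℝ) < Ideal.absNorm I := by
    exact_mod_cast Nat.pos_of_ne_zero fun h => hI (Ideal.absNorm_eq_zero_iff.mp h)
  have hs : 0 < √(Ideal.absNorm I : ℝ) := Real.sqrt_pos.mpr hN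
  -- The height with t² = 1/√N balances the two bounds N t² and 1/t², both equal to √N.
  have ht : 0 < √(√(Ideal.absNorm I : ℝ))⁻¹ := Real.sqrt_pos.mpr (inv_pos.mpr hs)
  have ht2 : √(√(Ideal.absNorm I : ℝ))⁻¹ ^ 2 = (√(Ideal.absNorm I : ℝ))⁻¹ :=
    Real.sq_sqrt (inv_pos.mpr hs).le
  refine ⟨axis _ ht, fun γ hγ h1 => le_twoCosh_of_mem_hecke0 hK φ hfree ht ?_ ?_ hγ h1⟩
  · rw [ht2, ← div_eq_mul_inv, Real.div_sqrt]
  · rw [ht2, mul_inv_cancel₀ hs.ne']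

theorem div_rpow_mul_rpow {w N e : ℝ} (a : ℝ) (hw : 0 < w) (hN : 0 ≤ N) :
    a / w ^ e * (N * w) ^ e = a * N ^ e := by
  rw [Real.mul_rpow hN hw.le]
  have := (Real.rpow_pos_of_pos hw e).ne'
  field_simp

end HypThree

/- The exceptional set can be taken to be empty, since only upper bounds for the degrees of the
covers are needed and these hold for all square-free ideals. -/
open HypThree HypThree.H3 in
theorem theorem1p5 (K : Type*) [Field K] [NumberField K] [NumberField.IsTotallyComplex K]
    (hK : Module.finrank ℚ K = 2) (φ : K →+* ℂ)
    (Γ' : Subgroup HypThree.PSL2C) (hΓ' : Γ' ≤ HypThree.bianchi φ)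
    (htf : HypThree.IsTorsionFree Γ') (hfin : HypThree.vol Γ' Set.univ ≠ ⊤) :
    ∃ S : Finset (IsDedekindDomain.HeightOneSpectrum (𝓞 K)),
      (∀ ε : ℝ, 0 < ε → ∃ d : ℝ, 0 < d ∧
        ∀ I : Ideal (𝓞 K), Squarefree I → (∀ P ∈ S, ¬ P.asIdeal ∣ I) →
          d < ((HypThree.Gamma0 φ Γ' I).relIndex Γ' : ℝ) →
          ∃ B : Set (HypThree.HypQuot (HypThree.Gamma0 φ Γ' I)),
            HypThree.IsEmbeddedBall (HypThree.Gamma0 φ Γ' I) B ∧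
            HypThree.vol (HypThree.Gamma0 φ Γ' I) Set.univ ^ (1 / 2 - ε) <
              HypThree.vol (HypThree.Gamma0 φ Γ' I) B) ∧
      (∃ c : ℝ, 0 < c ∧ ∃ d : ℝ, 0 < d ∧
        ∀ I : Ideal (𝓞 K), Squarefree I → (∀ P ∈ S, ¬ P.asIdeal ∣ I) →
          d < ((HypThree.Gamma1 φ Γ' I).relIndex Γ' : ℝ) →
          ∃ B : Set (HypThree.HypQuot (HypThree.Gamma1 φ Γ' I)),
            HypThree.IsEmbeddedBall (HypThree.Gamma1 φ Γ' I) B ∧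
            ENNReal.ofReal c *
                HypThree.vol (HypThree.Gamma1 φ Γ' I) Set.univ ^ (1 / 4 : ℝ) <
              HypThree.vol (HypThree.Gamma1 φ Γ' I) B) ∧
      (∃ c : ℝ, 0 < c ∧ ∃ d : ℝ, 0 < d ∧
        ∀ I : Ideal (𝓞 K), Squarefree I → (∀ P ∈ S, ¬ P.asIdeal ∣ I) →
          d < ((HypThree.GammaP φ Γ' I).relIndex Γ' : ℝ) →
          ∃ B : Set (HypThree.HypQuot (HypThree.GammaP φ Γ' I)),
            HypThree.IsEmbeddedBall (HypThree.GammaP φ Γ' I) B ∧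
            ENNReal.ofReal c *
                HypThree.vol (HypThree.GammaP φ Γ' I) Set.univ ^ (1 / 3 : ℝ) <
              HypThree.vol (HypThree.GammaP φ Γ' I) B) := by
  have hfree := actsFreely_of_isTorsionFree hK φ hΓ' htf
  obtain ⟨D, hD, hcov, hDfin⟩ := exists_measurable_cover_of_vol_ne_top hfin
  set v := (volume D).toReal with hv
  have hv0 : 0 ≤ v := ENNReal.toReal_nonneg
  have hcount : ∀ H : Subgroup PSL2C, Countable ↥(Γ' ⊓ H) := fun H =>
    countable_of_le_bianchi (inf_le_left.trans hΓ')
  have hidx : ∀ {n : ℕ} {d : ℝ}, 0 < d → d < n → n ≠ 0 := by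
    rintro n d hd h rfl
    rw [Nat.cast_zero] at h
    linarith
  refine ⟨∅, ?_, ?_, ?_⟩
  · intro ε hε
    -- Capping at 1/4 keeps the exponent `e` positive. Since the cover has volume at least 1, the
    -- bound with exponent `e` implies the one with 1/2 - ε.
    set δ := min ε (1 / 4) with hδ
    have hδ0 : 0 < δ := lt_min hε (by norm_num)
    have hδ4 : δ ≤ 1 / 4 := min_le_right _ _
    obtain ⟨C, hC, hind⟩ := index_hecke0_ne_zero_and_le (K := K) δ hδ0
    set e := 1 / 2 - δ with he
    -- Replacing v by v + 1 makes the constant positive without a lower bound for v.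
    set A := C * (v + 1) with hA
    have hA0 : 0 < A := by positivity
    -- The first entry ensures √N ≥ 32, the second N^(δ/2) > 64A^e/π.
    set N₀ := max 1024 ((64 * A ^ e / Real.pi) ^ (2 / δ)) with hN₀
    have hN₀1 : 1024 ≤ N₀ := le_max_left _ _
    -- As the degree is at most C N^(1+δ), exceeding this threshold forces N > N₀.
    refine ⟨C * N₀ ^ (1 + δ), by positivity, fun I hI _ hd => ?_⟩
    have hI0 : I ≠ ⊥ := hI.ne_zero
    obtain ⟨i1, i2⟩ := hind I hI
    have hrel : ((Gamma0 φ Γ' I).relIndex Γ' : ℝ) ≤ C * (Ideal.absNorm I : ℝ) ^ (1 + δ) :=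
      le_trans (by exact_mod_cast relIndex_inf_map_le φ hΓ' i1) i2
    set N : ℝ := (Ideal.absNorm I : ℝ)
    have hN0 : 0 ≤ N := Nat.cast_nonneg _
    have hNN : N₀ < N := by
      by_contra! h
      have := Real.rpow_le_rpow hN0 h (by positivity : 0 ≤ 1 + δ)
      nlinarith
    have hN1 : 1024 < N := hN₀1.trans_lt hNN
    obtain ⟨p, hp⟩ := exists_axis_sqrt_le_twoCosh hK φ hfree hI0
    have hX : 32 ≤ √N := Real.le_sqrt_of_sq_le (by linarith)
    have hW : ((Gamma0 φ Γ' I).relIndex Γ' : ℝ) * v ≤ A * N ^ (1 + δ) := by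
      calc _ ≤ C * N ^ (1 + δ) * (v + 1) := by gcongr; linarith
        _ = _ := by rw [hA]; ring
    have hlt : 1 * (A * N ^ (1 + δ)) ^ e < Real.pi / 64 * √N := by
      have h1 : 64 * A ^ e / Real.pi < N ^ (δ / 2) := by
        calc 64 * A ^ e / Real.pi = ((64 * A ^ e / Real.pi) ^ (2 / δ)) ^ (δ / 2) := by
              rw [← Real.rpow_mul (by positivity), div_mul_div_cancel₀ hδ0.ne',
                div_self two_ne_zero, Real.rpow_one]
          _ < N ^ (δ / 2) := Real.rpow_lt_rpow (by positivity)
              ((le_max_right _ _).trans_lt hNN) (by positivity)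
      -- Here (1 + δ)(1/2 - δ) = 1/2 - δ/2 - δ²; the spare N^(δ/2) then absorbs the constants.
      have h2 : N ^ ((1 + δ) * e) ≤ N ^ (1 / 2 - δ / 2) :=
        Real.rpow_le_rpow_of_exponent_le (by linarith) (by rw [he]; nlinarith)
      have h3 : N ^ (1 / 2 - δ / 2) * N ^ (δ / 2) = √N := by
        rw [← Real.rpow_add (by linarith), sub_add_cancel, Real.sqrt_eq_rpow]
      have h4 : 0 < N ^ (1 / 2 - δ / 2) := Real.rpow_pos_of_pos (by linarith) _
      rw [one_mul, Real.mul_rpow hA0.le (by positivity), ← Real.rpow_mul hN0, ← h3]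
      rw [div_lt_iff₀ Real.pi_pos] at h1
      calc A ^ e * N ^ ((1 + δ) * e) ≤ A ^ e * N ^ (1 / 2 - δ / 2) := by gcongr
        _ < (N ^ (δ / 2) * Real.pi / 64) * N ^ (1 / 2 - δ / 2) := by gcongr; linarith
        _ = _ := by ring
    have : Countable (Gamma0 φ Γ' I) := hcount _
    obtain ⟨hV, B, hB, hBv⟩ := exists_embeddedBall_of_cover (Γ₀ := Gamma0 φ Γ' I) inf_le_left hfree
      (hidx (by positivity) hd) hD hcov hDfin p hX hp hW zero_le_one
      (by rw [he]; linarith) hlt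
    rw [ENNReal.ofReal_one, one_mul] at hBv
    exact ⟨B, hB, (ENNReal.rpow_le_rpow_of_exponent_le hV
      (by rw [he]; linarith [min_le_left ε (1 / 4)])).trans_lt hBv⟩
  -- Taking π/128, half of the available π/64, makes the inequality strict. The degree is at most
  -- N², so the threshold 1024² gives N > 1024 and √N ≥ 32.
  · refine ⟨Real.pi / 128 / (v + 1) ^ (1 / 4 : ℝ), by positivity, 1024 ^ 2, by norm_num,
      fun I hI _ hd => ?_⟩
    have hI0 : I ≠ ⊥ := hI.ne_zero
    obtain ⟨i1, i2⟩ := index_hecke1 hI0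
    have hrel : ((Gamma1 φ Γ' I).relIndex Γ' : ℝ) ≤ (Ideal.absNorm I : ℝ) ^ 2 := by
      exact_mod_cast (relIndex_inf_map_le φ hΓ' i1).trans i2
    set N : ℝ := (Ideal.absNorm I : ℝ)
    have hN0 : 0 ≤ N := Nat.cast_nonneg _
    have hN1 : 1024 < N := lt_of_pow_lt_pow_left₀ 2 hN0 (hd.trans_le hrel)
    obtain ⟨p, hp⟩ := exists_axis_sqrt_le_twoCosh hK φ hfree hI0
    have hX : 32 ≤ √N := Real.le_sqrt_of_sq_le (by linarith)
    have hW : ((Gamma1 φ Γ' I).relIndex Γ' : ℝ) * v ≤ N ^ 2 * (v + 1) := by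
      gcongr
      linarith
    have : Countable (Gamma1 φ Γ' I) := hcount _
    refine (exists_embeddedBall_of_cover (Γ₀ := Gamma1 φ Γ' I) inf_le_left hfree
      (hidx (by norm_num) hd) hD hcov hDfin p hX
      (fun γ hγ => hp γ ⟨hγ.1, Subgroup.map_mono (hecke1_le_hecke0 I) hγ.2⟩) hW
      (by positivity) (by norm_num) ?_).2
    rw [div_rpow_mul_rpow _ (by positivity) (by positivity), ← Real.rpow_natCast,
      ← Real.rpow_mul hN0, Real.sqrt_eq_rpow]
    norm_num
    have := Real.rpow_pos_of_pos (by linarith : 0 < N) (1 / 2)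
    gcongr
    norm_num
  -- Here the displacement bound is N itself and the degree is at most N³, so the threshold 32³
  -- suffices.
  · refine ⟨Real.pi / 128 / (v + 1) ^ (1 / 3 : ℝ), by positivity, 32 ^ 3, by norm_num,
      fun I hI _ hd => ?_⟩
    have hI0 : I ≠ ⊥ := hI.ne_zero
    obtain ⟨i1, i2⟩ := index_principal hI0
    have hrel : ((GammaP φ Γ' I).relIndex Γ' : ℝ) ≤ (Ideal.absNorm I : ℝ) ^ 3 := by
      exact_mod_cast (relIndex_inf_map_le φ hΓ' i1).trans i2
    have hp : ∀ γ ∈ GammaP φ Γ' I, γ ≠ 1 → (Ideal.absNorm I : ℝ) ≤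
        twoCosh (γ • axis 1 one_pos) (axis 1 one_pos) :=
      fun γ hγ => absNorm_le_twoCosh_of_mem_principal hK φ hfree hγ
    set N : ℝ := (Ideal.absNorm I : ℝ)
    have hN0 : 0 ≤ N := Nat.cast_nonneg _
    have hN1 : 32 < N := lt_of_pow_lt_pow_left₀ 3 hN0 (hd.trans_le hrel)
    have hW : ((GammaP φ Γ' I).relIndex Γ' : ℝ) * v ≤ N ^ 3 * (v + 1) := by
      gcongr
      linarith
    have : Countable (GammaP φ Γ' I) := hcount _
    refine (exists_embeddedBall_of_cover (Γ₀ := GammaP φ Γ' I) inf_le_left hfree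
      (hidx (by norm_num) hd) hD hcov hDfin _ hN1.le hp hW
      (by positivity) (by norm_num) ?_).2
    rw [div_rpow_mul_rpow _ (by positivity) (by positivity), ← Real.rpow_natCast,
      ← Real.rpow_mul hN0]
    norm_num
    linarith [mul_lt_mul_of_pos_right (div_lt_div_of_pos_left Real.pi_pos
      (by norm_num : (0 : ℝ) < 64) (by norm_num : (64 : ℝ) < 128)) (by linarith : 0 < N)]
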